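/- Let $T>0$, let $\Omega\subset\mathbb R^N$ be a bounded domain, $\Omega_T=(0,T)\times\Omega$, and write $(k*v)(t)=\int_0^t k(t-\tau)v(\tau)\,d\tau$. Let $k,l\in L_{1,loc}([0,\infty))$, where $k$ is nonnegative and nonincreasing and $k*l=1$ on $(0,\infty)$. For $n\in\mathbb N$, $n\ge 1$, let $h_n\in L_{1,loc}([0,\infty))$ be the resolvent kernel associated with $n\,l$, that is, the solution of $h_n+n\,(h_n*l)=n\,l$ on $(0,\infty)$, and put $k_n=k*h_n$. Let $\Phi:\mathbb R\to\mathbb R$ be continuous and strictly increasing with $\Phi(0)=0$, let $a:\Omega_T\to\mathbb R$ be measurable with $0<a_1\le a(t,x)\le a_2$ for almost all $(t,x)\in\Omega_T$, with constants $a_1,a_2$, and let $u_0\in L_2(\Omega)$ and $f\in L_2(\Omega_T)$. Let $\mathring H^1_2(\Omega)$ be the closure of $C_0^\infty(\Omega)$ in $H^1_2(\Omega)$. Then the problem $$\partial_t\big(k*[u-u_0]\big)-\Delta\big(a\Phi(u)\big)=f\ \text{ in }\Omega_T,\qquad u=0\ \text{ on }(0,T)\times\partial\Omega,\qquad u|_{t=0}=u_0\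 \text{ in }\Omega$$ has at most one weak solution $u$ (up to equality almost everywhere in $\Omega_T$) in the following sense: $u\in L_2(\Omega_T)$; $k*u\in C([0,T];L_2(\Omega))$ with $(k*u)|_{t=0}=0$; $a\Phi(u)\in L_2((0,T);\mathring H^1_2(\Omega))$; and for all $\psi\in\mathring H^1_2(\Omega)$ and all integers $n\ge1$, $$\int_\Omega\Big(\psi\,\partial_t\big(k_n*[u-u_0]\big)+\big[h_n*\nabla(a\Phi(u))\big]\cdot\nabla\psi\Big)\,dx=\int_\Omega (h_n*f)\,\psi\,dx\quad\text{for almost all }t\in(0,T).$$ Here $\partial_t(k_n*[u-u_0])\in L_2(\Omega_T)$ is the weak time derivative. -/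

import Mathlib

open MeasureTheory Set
open scoped ENNReal ContDiff

noncomputable section

namespace Subdiffusion

/-- Convolution on the positive half-line: `(k ∗ v)(t) = ∫₀ᵗ k(t - τ) v(τ) dτ`. -/
def conv {F : Type*} [NormedAddCommGroup F] [NormedSpace ℝ F]
    (k : ℝ → ℝ) (v : ℝ → F) (t : ℝ) : F :=
  ∫ τ in (0 : ℝ)..t, k (t - τ) • v τ

/-- `(k, l) ∈ 𝒫𝒞`: `k` and `l` are locally integrable on `[0, ∞)`, `k` is nonnegative and
nonincreasing on `(0, ∞)`, and `k ∗ l = 1` on `(0, ∞)` (as functions in `L_{1,loc}`). -/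
structure IsPCPair (k l : ℝ → ℝ) : Prop where
  locallyIntegrable_left : LocallyIntegrableOn k (Ici 0)
  nonneg : ∀ t, 0 < t → 0 ≤ k t
  antitone : AntitoneOn k (Ioi 0)
  locallyIntegrable_right : LocallyIntegrableOn l (Ici 0)
  conv_eq_one : ∀ᵐ t ∂(volume.restrict (Ioi (0 : ℝ))), conv k l t = 1

/-- `h ∈ L_{1,loc}([0, ∞))` solves the Volterra equation `h + γ (h ∗ l) = γ l` on `(0, ∞)`. -/
structure IsResolventKernel (γ : ℝ) (l h : ℝ → ℝ) : Prop where
  locallyIntegrable : LocallyIntegrableOn h (Ici 0)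
  volterra : ∀ᵐ t ∂(volume.restrict (Ioi (0 : ℝ))), h t + γ * conv h l t = γ * l t

/-- The resolvent kernel `h_γ` associated with `γ l`. For locally integrable `l` the Volterra
equation has a solution, unique up to null sets of `(0, ∞)`; a representative is chosen. -/
def resolventKernel (γ : ℝ) (l : ℝ → ℝ) : ℝ → ℝ :=
  Classical.epsilon (IsResolventKernel γ l)

/-- The regularized kernel `k_γ = k ∗ h_γ`. -/
def regularizedKernel (γ : ℝ) (k l : ℝ → ℝ) : ℝ → ℝ :=
  conv k (resolventKernel γ l)

/-- `φ ∈ C_0^∞(U)`. -/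
structure IsTestFunction {X : Type*} [NormedAddCommGroup X] [NormedSpace ℝ X]
    (U : Set X) (φ : X → ℝ) : Prop where
  smooth : ContDiff ℝ ∞ φ
  compact : HasCompactSupport φ
  support_subset : tsupport φ ⊆ U

/-- `g` is the weak gradient of `w` in `Ω`. -/
def IsWeakGradient {N : ℕ} (Ω : Set (EuclideanSpace ℝ (Fin N)))
    (w : EuclideanSpace ℝ (Fin N) → ℝ)
    (g : EuclideanSpace ℝ (Fin N) → EuclideanSpace ℝ (Fin N)) : Prop :=
  ∀ φ : EuclideanSpace ℝ (Fin N) → ℝ, IsTestFunction Ω φ →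
    ∫ x in Ω, w x • gradient φ x = -∫ x in Ω, φ x • g x

/-- `w` belongs to the closure of `C_0^∞(Ω)` in `H^1_2(Ω)`, and `g = ∇w` is its weak gradient. -/
structure MemH10 {N : ℕ} (Ω : Set (EuclideanSpace ℝ (Fin N)))
    (w : EuclideanSpace ℝ (Fin N) → ℝ)
    (g : EuclideanSpace ℝ (Fin N) → EuclideanSpace ℝ (Fin N)) : Prop where
  memLp : MemLp w 2 (volume.restrict Ω)
  memLp_grad : MemLp g 2 (volume.restrict Ω)
  weakGradient : IsWeakGradient Ω w g
  approx : ∀ ε : ℝ≥0∞, 0 < ε → ∃ φ : EuclideanSpace ℝ (Fin N) → ℝ, IsTestFunction Ω φ ∧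
    eLpNorm (fun x => w x - φ x) 2 (volume.restrict Ω) < ε ∧
    eLpNorm (fun x => g x - gradient φ x) 2 (volume.restrict Ω) < ε

/-- The space-time cylinder `Ω_T = (0, T) × Ω`. -/
def cylinder {N : ℕ} (T : ℝ) (Ω : Set (EuclideanSpace ℝ (Fin N))) :
    Set (ℝ × EuclideanSpace ℝ (Fin N)) :=
  Ioo 0 T ×ˢ Ω

/-- `w` belongs to `L_2((0, T); H̊^1_2(Ω))`, and `G = ∇w` is its spatial weak gradient. -/
structure MemL2H10 {N : ℕ} (T : ℝ) (Ω : Set (EuclideanSpace ℝ (Fin N)))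
    (w : ℝ × EuclideanSpace ℝ (Fin N) → ℝ)
    (G : ℝ × EuclideanSpace ℝ (Fin N) → EuclideanSpace ℝ (Fin N)) : Prop where
  memLp : MemLp w 2 (volume.restrict (cylinder T Ω))
  memLp_grad : MemLp G 2 (volume.restrict (cylinder T Ω))
  memH10 : ∀ᵐ t ∂(volume.restrict (Ioo 0 T)), MemH10 Ω (fun x => w (t, x)) (fun x => G (t, x))

/-- `D` is the weak time derivative `∂_t v` in `Ω_T`. -/
def IsWeakTimeDeriv {N : ℕ} (T : ℝ) (Ω : Set (EuclideanSpace ℝ (Fin N)))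
    (v D : ℝ × EuclideanSpace ℝ (Fin N) → ℝ) : Prop :=
  ∀ θ : ℝ × EuclideanSpace ℝ (Fin N) → ℝ, IsTestFunction (cylinder T Ω) θ →
    ∫ p in cylinder T Ω, v p * deriv (fun s => θ (s, p.2)) p.1 =
      -∫ p in cylinder T Ω, D p * θ p

/-- `v ∈ C([0, T]; L_2(Ω))` with `v|_{t = 0} = 0`, for `v` given up to null sets of `Ω_T`. -/
def IsContinuousL2VanishingAtZero {N : ℕ} (T : ℝ) (Ω : Set (EuclideanSpace ℝ (Fin N)))
    (v : ℝ × EuclideanSpace ℝ (Fin N) → ℝ) : Prop :=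
  ∃ V : ℝ → Lp ℝ 2 (volume.restrict Ω), ContinuousOn V (Icc 0 T) ∧ V 0 = 0 ∧
    ∀ᵐ t ∂(volume.restrict (Ioo 0 T)), V t =ᵐ[volume.restrict Ω] fun x => v (t, x)

/-- `u` is a weak solution of `∂_t(k ∗ [u - u₀]) - Δ(a Φ(u)) = f` in `Ω_T` with homogeneous
Dirichlet boundary condition and initial value `u₀`, in the time-regularized sense. Here `G` is
the gradient `∇(a Φ(u))` and, for each `n`, `D` is the time derivative `∂_t(k_n ∗ [u - u₀])`;
both are determined up to null sets. -/
structure IsWeakSolution {N : ℕ} (T : ℝ) (Ω : Set (EuclideanSpace ℝ (Fin N))) (k l : ℝ → ℝ)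
    (a : ℝ × EuclideanSpace ℝ (Fin N) → ℝ) (Φ : ℝ → ℝ)
    (u₀ : EuclideanSpace ℝ (Fin N) → ℝ) (f u : ℝ × EuclideanSpace ℝ (Fin N) → ℝ) : Prop where
  memLp : MemLp u 2 (volume.restrict (cylinder T Ω))
  continuous_conv :
    IsContinuousL2VanishingAtZero T Ω fun p => conv k (fun τ => u (τ, p.2)) p.1
  weak_form : ∃ G : ℝ × EuclideanSpace ℝ (Fin N) → EuclideanSpace ℝ (Fin N),
    MemL2H10 T Ω (fun p => a p * Φ (u p)) G ∧
    ∀ n : ℕ, 0 < n → ∃ D : ℝ × EuclideanSpace ℝ (Fin N) → ℝ,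
      MemLp D 2 (volume.restrict (cylinder T Ω)) ∧
      IsWeakTimeDeriv T Ω
        (fun p => conv (regularizedKernel n k l) (fun τ => u (τ, p.2) - u₀ p.2) p.1) D ∧
      ∀ (ψ : EuclideanSpace ℝ (Fin N) → ℝ)
        (g : EuclideanSpace ℝ (Fin N) → EuclideanSpace ℝ (Fin N)), MemH10 Ω ψ g →
        ∀ᵐ t ∂(volume.restrict (Ioo 0 T)),
          ∫ x in Ω, (ψ x * D (t, x) +
              inner ℝ (conv (resolventKernel n l) (fun τ => G (τ, x)) t) (g x)) =
            ∫ x in Ω, conv (resolventKernel n l) (fun τ => f (τ, x)) t * ψ x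

end Subdiffusion

end

/-! Let `z = a (Φ(u₁) - Φ(u₂))`. For a fixed test function `φ` put `U = ∫ (u₁ - u₂) φ` and `g = ∫ ∇z
· ∇φ`, two scalar functions of time. The difference of the weak formulations reads `∂_t(k ∗ h ∗ U) +
h ∗ g = 0`, so `h ∗ (k ∗ U + 1 ∗ g)` is constant. The constant is zero because `k ∗ U` is bounded,
and convolution with `h` is injective, hence `k ∗ U + 1 ∗ g = 0`. Convolving with `l` and
differentiating gives `U + l ∗ g = 0` (`IsResolventKernel.ae_add_conv_eq_zero`). One value of `n`
suffices, and no limit in `n` is taken.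

This equation contains no time derivative, so at almost every fixed `t` it can be tested with `z(t,
·)` itself; `exists_countable_testFunctions` makes the exceptional set of times independent of the
test function. Integration in time yields `∫∫ (u₁ - u₂) z + ∫∫ (l ∗ ∇z) · ∇z = 0`. The first
integrand is nonnegative since `a > 0` and `Φ` is increasing; the second integral is nonnegative
since `l` is of positive type (`integral_inner_timeConv_nonneg`). Both vanish, and strict
monotonicity of `Φ` gives `u₁ = u₂`.

Positivity of `l` is inherited from the monotonicity of `k`. For `w = 1 ∗ q` and `r = l ∗ q`, the
identity `k ∗ l = 1` gives `w = k ∗ r` and `l ∗ w = 1 ∗ r`, so the form becomes `∫ ⟨1 ∗ r, k ∗ r⟩`.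
By the layer-cake formula `k` is a superposition of indicators of intervals `(0, ρ)`. For such an
indicator the form is `∫ ⟨V, V - V(· - ρ)⟩` with `V = 1 ∗ r`, which is nonnegative because `V`
vanishes for `t ≤ 0`. Functions `1 ∗ q` are dense in `L_2(Ω_T)`, and the form is continuous there.
-/

namespace Subdiffusion

open Filter Topology
open scoped Convolution

/-! ### Convolution on the half-line: algebra and the kernel `1`. -/

section Line

variable {F : Type*} [NormedAddCommGroup F] [NormedSpace ℝ F] {T t : ℝ}

theorem integrableOn_Ioo_of_locallyIntegrableOn {F : Type*} [NormedAddCommGroup F] {k : ℝ → F}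
    (hk : LocallyIntegrableOn k (Ici 0)) (T : ℝ) : IntegrableOn k (Ioo 0 T) :=
  (hk.integrableOn_compact_subset Icc_subset_Ici_self isCompact_Icc).mono_set Ioo_subset_Icc_self

theorem indicator_smul_indicator_eq (k : ℝ → ℝ) (v : ℝ → F) (ht : t ∈ Ioo 0 T) (s : ℝ) :
    (Ioo 0 T).indicator k (t - s) • (Ioo 0 T).indicator v s =
      (Ioo 0 t).indicator (fun s => k (t - s) • v s) s := by
  by_cases hs : s ∈ Ioo 0 t
  · have h1 : t - s ∈ Ioo 0 T := ⟨by linarith [hs.2], by linarith [hs.1, ht.2]⟩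
    have h2 : s ∈ Ioo 0 T := ⟨hs.1, hs.2.trans ht.2⟩
    simp [hs, h1, h2]
  · rw [indicator_of_notMem hs]
    by_cases h2 : s ∈ Ioo 0 T
    · have h1 : t - s ∉ Ioo 0 T := fun h => hs ⟨h2.1, by linarith [h.1]⟩
      simp [h1]
    · simp [h2]

theorem conv_eq_setIntegral (k : ℝ → ℝ) (v : ℝ → F) (ht : 0 ≤ t) :
    conv k v t = ∫ s in Ioo 0 t, k (t - s) • v s := by
  rw [conv, intervalIntegral.integral_of_le ht, integral_Ioc_eq_integral_Ioo]

theorem conv_eq_integral (k : ℝ → ℝ) (v : ℝ → F) (ht : t ∈ Ioo 0 T) :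
    conv k v t = ∫ s, (Ioo 0 T).indicator k (t - s) • (Ioo 0 T).indicator v s := by
  simp_rw [indicator_smul_indicator_eq k v ht]
  rw [conv_eq_setIntegral k v ht.1.le, integral_indicator measurableSet_Ioo]

/-- Extension by zero outside `(0, T)` reduces everything to convolution on the whole line, where
existence, integrability and associativity are standard. -/
theorem conv_eq_convolution (k : ℝ → ℝ) (v : ℝ → F) (ht : t ∈ Ioo 0 T) :
    conv k v t =
      ((Ioo 0 T).indicator k ⋆[ContinuousLinearMap.lsmul ℝ ℝ, volume] (Ioo 0 T).indicator v) t := by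
  rw [convolution_lsmul_swap, conv_eq_integral k v ht]

theorem indicator_ae_eq {X Y : Type*} [MeasurableSpace X] [Zero Y] {μ : Measure X} {s : Set X}
    (hs : MeasurableSet s) {f g : X → Y}
    (h : f =ᵐ[μ.restrict s] g) : s.indicator f =ᵐ[μ] s.indicator g := by
  rw [EventuallyEq, ae_restrict_iff' hs] at h
  filter_upwards [h] with x hx
  by_cases hxs : x ∈ s <;> simp [hxs, hx]

theorem conv_congr {k k' : ℝ → ℝ} {v v' : ℝ → F}
    (hk : k =ᵐ[volume.restrict (Ioo 0 T)] k') (hv : v =ᵐ[volume.restrict (Ioo 0 T)] v')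
    (ht : t ∈ Ioo 0 T) : conv k v t = conv k' v' t := by
  rw [conv_eq_convolution k v ht, conv_eq_convolution k' v' ht,
    convolution_congr _ (indicator_ae_eq measurableSet_Ioo hk)
      (indicator_ae_eq measurableSet_Ioo hv)]

theorem integrableOn_conv {k : ℝ → ℝ} {v : ℝ → F} (hk : IntegrableOn k (Ioo 0 T))
    (hv : IntegrableOn v (Ioo 0 T)) : IntegrableOn (conv k v) (Ioo 0 T) := by
  have := ((hk.integrable_indicator measurableSet_Ioo).integrable_convolution
    (ContinuousLinearMap.lsmul ℝ ℝ) (hv.integrable_indicator measurableSet_Ioo)).integrableOn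
      (s := Ioo 0 T)
  exact this.congr_fun (fun t ht => (conv_eq_convolution k v ht).symm) measurableSet_Ioo

theorem ae_intervalIntegrable_conv {k : ℝ → ℝ} {v : ℝ → F} (hk : IntegrableOn k (Ioo 0 T))
    (hv : IntegrableOn v (Ioo 0 T)) : ∀ᵐ t ∂(volume.restrict (Ioo 0 T)),
      IntervalIntegrable (fun s => k (t - s) • v s) volume 0 t := by
  rw [ae_restrict_iff' measurableSet_Ioo]
  filter_upwards [(hk.integrable_indicator measurableSet_Ioo).ae_convolution_exists
    (ContinuousLinearMap.lsmul ℝ ℝ) (hv.integrable_indicator measurableSet_Ioo)] with t h ht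
  have h' := h.integrable_swap
  simp only [ContinuousLinearMap.lsmul_apply] at h'
  simp_rw [indicator_smul_indicator_eq k v ht] at h'
  rw [intervalIntegrable_iff_integrableOn_Ioo_of_le ht.1.le]
  exact (integrable_indicator_iff measurableSet_Ioo).1 h'

theorem conv_comm (k l : ℝ → ℝ) (t : ℝ) : conv k l t = conv l k t := by
  have := intervalIntegral.integral_comp_sub_left (a := 0) (b := t)
    (fun τ => k (t - τ) * l τ) t
  simp only [sub_sub_cancel, sub_zero, sub_self] at this
  rw [conv, conv]
  simp only [smul_eq_mul]
  rw [← this]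
  simp_rw [mul_comm]

/-- The whole-line convolution of two truncations lives on `(0, 2T)`; below `T` it agrees with the
truncated half-line convolution. This is what permits iterated convolutions to be truncated at each
stage. -/
theorem convolution_indicator_eq (a : ℝ → ℝ) (b : ℝ → F) {r : ℝ} (hr : r < T) :
    ((Ioo 0 T).indicator a ⋆[ContinuousLinearMap.lsmul ℝ ℝ, volume] (Ioo 0 T).indicator b) r =
      (Ioo 0 T).indicator (conv a b) r := by
  by_cases h : r ∈ Ioo 0 T
  · rw [indicator_of_mem h, conv_eq_convolution a b h]
  · rw [indicator_of_notMem h, convolution_lsmul]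
    refine integral_eq_zero_of_ae (ae_of_all _ fun s => ?_)
    by_cases hs : s ∈ Ioo 0 T
    · have : r - s ∉ Ioo 0 T := fun h' => h ⟨by linarith [hs.1, h'.1], hr⟩
      simp [this]
    · simp [hs]

theorem conv_assoc [CompleteSpace F] {k l : ℝ → ℝ} {v : ℝ → F} (hk : IntegrableOn k (Ioo 0 T))
    (hl : IntegrableOn l (Ioo 0 T)) (hv : IntegrableOn v (Ioo 0 T)) :
    ∀ᵐ t ∂(volume.restrict (Ioo 0 T)), conv (conv k l) v t = conv k (conv l v) t := by
  have hk' := hk.integrable_indicator measurableSet_Ioo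
  have hl' := hl.integrable_indicator measurableSet_Ioo
  have hv' := hv.integrable_indicator measurableSet_Ioo
  rw [ae_restrict_iff' measurableSet_Ioo]
  filter_upwards [hk'.norm.ae_convolution_exists (ContinuousLinearMap.mul ℝ ℝ)
    (hl'.norm.integrable_convolution (ContinuousLinearMap.mul ℝ ℝ) hv'.norm)] with t h ht
  have h3 := convolution_assoc (𝕜 := ℝ) (L := ContinuousLinearMap.lsmul ℝ ℝ)
    (L₂ := ContinuousLinearMap.lsmul ℝ ℝ (E := F)) (L₃ := ContinuousLinearMap.lsmul ℝ ℝ)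
    (L₄ := ContinuousLinearMap.lsmul ℝ ℝ)
    (fun x y z => by simp [smul_smul, mul_comm]) hk'.aestronglyMeasurable
    hl'.aestronglyMeasurable hv'.aestronglyMeasurable
    (hk'.ae_convolution_exists _ hl')
    (hl'.norm.ae_convolution_exists _ hv'.norm) h
  rw [conv_eq_convolution _ v ht, conv_eq_convolution k _ ht]
  have e1 : ((Ioo 0 T).indicator (conv k l) ⋆[ContinuousLinearMap.lsmul ℝ ℝ, volume]
      (Ioo 0 T).indicator v) t = (((Ioo 0 T).indicator k ⋆[ContinuousLinearMap.lsmul ℝ ℝ, volume]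
        (Ioo 0 T).indicator l) ⋆[ContinuousLinearMap.lsmul ℝ ℝ, volume]
      (Ioo 0 T).indicator v) t := by
    rw [convolution_lsmul_swap, convolution_lsmul_swap]
    refine integral_congr_ae (ae_of_all _ fun s => ?_)
    by_cases hs : s ∈ Ioo 0 T
    · beta_reduce
      rw [convolution_indicator_eq k l (show t - s < T by linarith [hs.1, ht.2])]
    · simp [hs]
  have e2 : ((Ioo 0 T).indicator k ⋆[ContinuousLinearMap.lsmul ℝ ℝ, volume]
      (Ioo 0 T).indicator (conv l v)) t = ((Ioo 0 T).indicator k ⋆[ContinuousLinearMap.lsmul ℝ ℝ, volume]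
        ((Ioo 0 T).indicator l ⋆[ContinuousLinearMap.lsmul ℝ ℝ, volume]
      (Ioo 0 T).indicator v)) t := by
    rw [convolution_lsmul, convolution_lsmul]
    refine integral_congr_ae (ae_of_all _ fun s => ?_)
    by_cases hs : s ∈ Ioo 0 T
    · beta_reduce
      rw [convolution_indicator_eq l v (show t - s < T by linarith [hs.1, ht.2])]
    · simp [hs]
  rw [e1, e2, h3]

theorem conv_one (v : ℝ → F) (t : ℝ) : conv (fun _ => 1) v t = ∫ s in (0 : ℝ)..t, v s := by
  simp [conv]

theorem conv_const_smul (k : ℝ → ℝ) (c : ℝ) (v : ℝ → F) (t : ℝ) :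
    conv k (fun s => c • v s) t = c • conv k v t := by
  simp_rw [conv, smul_comm _ c]
  exact intervalIntegral.integral_smul _ _

theorem conv_add {k : ℝ → ℝ} {v w : ℝ → F} (hk : IntegrableOn k (Ioo 0 T))
    (hv : IntegrableOn v (Ioo 0 T)) (hw : IntegrableOn w (Ioo 0 T)) :
    ∀ᵐ t ∂(volume.restrict (Ioo 0 T)),
      conv k (fun s => v s + w s) t = conv k v t + conv k w t := by
  filter_upwards [ae_intervalIntegrable_conv hk hv, ae_intervalIntegrable_conv hk hw] with t h1 h2
  simp_rw [conv, smul_add]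
  exact intervalIntegral.integral_add h1 h2

theorem conv_sub {k : ℝ → ℝ} {v w : ℝ → F} (hk : IntegrableOn k (Ioo 0 T))
    (hv : IntegrableOn v (Ioo 0 T)) (hw : IntegrableOn w (Ioo 0 T)) :
    ∀ᵐ t ∂(volume.restrict (Ioo 0 T)),
      conv k (fun s => v s - w s) t = conv k v t - conv k w t := by
  filter_upwards [ae_intervalIntegrable_conv hk hv, ae_intervalIntegrable_conv hk hw] with t h1 h2
  simp_rw [conv, smul_sub]
  exact intervalIntegral.integral_sub h1 h2

theorem continuousOn_conv_one {v : ℝ → F} (hT : 0 ≤ T) (hv : IntegrableOn v (Ioo 0 T)) :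
    ContinuousOn (conv (fun _ => 1) v) (Icc 0 T) := by
  have h := intervalIntegral.continuousOn_primitive_interval' (a := 0) (b₁ := 0) (b₂ := T)
    ((intervalIntegrable_iff_integrableOn_Ioo_of_le hT).2 hv) left_mem_uIcc
  rw [uIcc_of_le hT] at h
  exact h.congr fun t _ => conv_one v t

/-- The primitive is continuous, so it vanishes everywhere on `(0, T)`; Lebesgue differentiation
then recovers `v`. -/
theorem ae_eq_zero_of_conv_one_eq_zero [CompleteSpace F] {v : ℝ → F} (hT : 0 < T)
    (hv : IntegrableOn v (Ioo 0 T))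
    (h : ∀ᵐ t ∂(volume.restrict (Ioo 0 T)), conv (fun _ => 1) v t = 0) :
    ∀ᵐ t ∂(volume.restrict (Ioo 0 T)), v t = 0 := by
  have hc := (continuousOn_conv_one hT.le hv).mono Ioo_subset_Icc_self
  have h0 : EqOn (conv (fun _ => 1) v) 0 (Ioo 0 T) :=
    Measure.eqOn_open_of_ae_eq h isOpen_Ioo hc continuousOn_const
  have hd := ((intervalIntegrable_iff_integrableOn_Ioo_of_le hT.le).2 hv).ae_hasDerivAt_integral
  rw [ae_restrict_iff' measurableSet_Ioo]
  filter_upwards [hd] with t hd ht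
  have h1 := hd (by rw [uIcc_of_le hT.le]; exact Ioo_subset_Icc_self ht) 0 left_mem_uIcc
  have h2 : (fun x => ∫ s in (0 : ℝ)..x, v s) =ᶠ[𝓝 t] fun _ => 0 := by
    filter_upwards [isOpen_Ioo.mem_nhds ht] with x hx
    rw [← conv_one]; exact h0 hx
  exact h1.unique ((hasDerivAt_const t (0 : F)).congr_of_eventuallyEq h2)

end Line

/-! ### Existence of the resolvent kernel and injectivity of convolution with it. -/

section Resolvent

variable {T : ℝ}

theorem ae_summable_of_summable_integral_norm {α E : Type*} [MeasurableSpace α] {μ : Measure α}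
    [NormedAddCommGroup E] {f : ℕ → α → E} (hf : ∀ j, Integrable (f j) μ)
    (hs : Summable fun j => ∫ a, ‖f j a‖ ∂μ) :
    ∀ᵐ a ∂μ, Summable fun j => ‖f j a‖ := by
  have h1 : ∫⁻ a, ∑' j, ‖f j a‖ₑ ∂μ ≠ ⊤ := by
    rw [lintegral_tsum fun j => (hf j).aestronglyMeasurable.enorm]
    have : ∀ j, ∫⁻ a, ‖f j a‖ₑ ∂μ = ENNReal.ofReal (∫ a, ‖f j a‖ ∂μ) := fun j =>
      (ofReal_integral_norm_eq_lintegral_enorm (hf j)).symm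
    simp_rw [this]
    rw [← ENNReal.ofReal_tsum_of_nonneg (fun j => integral_nonneg fun _ => norm_nonneg _) hs]
    exact ENNReal.ofReal_ne_top
  have hm : AEMeasurable (fun a => ∑' j, ‖f j a‖ₑ) μ :=
    AEMeasurable.tsum fun j => (hf j).aestronglyMeasurable.enorm
  filter_upwards [ae_lt_top' hm h1] with a ha
  have := ENNReal.summable_toReal ha.ne
  simpa using this

theorem integrable_tsum_of_summable_integral_norm {α E : Type*} [MeasurableSpace α] {μ : Measure α}
    [NormedAddCommGroup E] [CompleteSpace E] {f : ℕ → α → E} (hf : ∀ j, Integrable (f j) μ)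
    (hs : Summable fun j => ∫ a, ‖f j a‖ ∂μ) :
    Integrable (fun a => ∑' j, f j a) μ := by
  have hsum := ae_summable_of_summable_integral_norm hf hs
  have hm : AEStronglyMeasurable (fun a => ∑' j, f j a) μ := by
    refine aestronglyMeasurable_of_tendsto_ae atTop
      (f := fun n a => ∑ j ∈ Finset.range n, f j a) (fun n => ?_) ?_
    · exact Finset.aestronglyMeasurable_fun_sum _ fun j _ => (hf j).aestronglyMeasurable
    · filter_upwards [hsum] with a ha
      exact ha.of_norm.hasSum.tendsto_sum_nat
  have h1 : ∫⁻ a, ∑' j, ‖f j a‖ₑ ∂μ < ⊤ := by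
    rw [lintegral_tsum fun j => (hf j).aestronglyMeasurable.enorm]
    have : ∀ j, ∫⁻ a, ‖f j a‖ₑ ∂μ = ENNReal.ofReal (∫ a, ‖f j a‖ ∂μ) := fun j =>
      (ofReal_integral_norm_eq_lintegral_enorm (hf j)).symm
    simp_rw [this]
    rw [← ENNReal.ofReal_tsum_of_nonneg (fun j => integral_nonneg fun _ => norm_nonneg _) hs]
    exact ENNReal.ofReal_lt_top
  refine ⟨hm, lt_of_le_of_lt (lintegral_mono_ae ?_) h1⟩
  filter_upwards [hsum] with a ha
  rw [← ofReal_norm]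
  refine (ENNReal.ofReal_le_ofReal (norm_tsum_le_tsum_norm ha)).trans ?_
  rw [ENNReal.ofReal_tsum_of_nonneg (fun _ => norm_nonneg _) ha]
  simp

theorem integrableOn_exp_mul {c : ℝ} {k : ℝ → ℝ} (hk : IntegrableOn k (Ioo 0 T)) :
    IntegrableOn (fun t => Real.exp (-c * t) * ‖k t‖) (Ioo 0 T) := by
  refine (Integrable.bdd_mul (c := Real.exp (|c| * T)) hk.norm ?_ ?_)
  · exact (by fun_prop : Continuous fun t => Real.exp (-c * t)).aestronglyMeasurable
  · rw [ae_restrict_iff' measurableSet_Ioo]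
    refine ae_of_all _ fun t ht => ?_
    rw [Real.norm_eq_abs, Real.abs_exp, Real.exp_le_exp]
    calc -c * t ≤ |c| * t := by gcongr; exacts [ht.1.le, neg_le_abs c]
      _ ≤ |c| * T := by gcongr; exact ht.2.le

/-- The weight factors as `exp(-ct) = exp(-c(t - s)) exp(-cs)`, so Young's `L_1` inequality survives
in the weighted norm. -/
theorem integral_exp_mul_norm_conv_le (c : ℝ) {k l : ℝ → ℝ} (hk : IntegrableOn k (Ioo 0 T))
    (hl : IntegrableOn l (Ioo 0 T)) :
    ∫ t in Ioo 0 T, Real.exp (-c * t) * ‖conv k l t‖ ≤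
      (∫ t in Ioo 0 T, Real.exp (-c * t) * ‖k t‖) *
        ∫ t in Ioo 0 T, Real.exp (-c * t) * ‖l t‖ := by
  have hk' := (integrableOn_exp_mul (c := c) hk).integrable_indicator measurableSet_Ioo
  have hl' := (integrableOn_exp_mul (c := c) hl).integrable_indicator measurableSet_Ioo
  rw [← integral_indicator (f := fun t => Real.exp (-c * t) * ‖k t‖) measurableSet_Ioo,
    ← integral_indicator (f := fun t => Real.exp (-c * t) * ‖l t‖) measurableSet_Ioo,
    ← ContinuousLinearMap.mul_apply' ℝ ℝ,
    ← integral_convolution (ContinuousLinearMap.mul ℝ ℝ) hk' hl']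
  have hI := hk'.integrable_convolution (ContinuousLinearMap.mul ℝ ℝ) hl'
  refine (setIntegral_mono_on (integrableOn_exp_mul (integrableOn_conv hk hl)) hI.integrableOn
    measurableSet_Ioo fun t ht => ?_).trans (setIntegral_le_integral hI (ae_of_all _ fun t => ?_))
  · rw [conv_eq_integral k l ht, convolution_mul_swap]
    refine (mul_le_mul_of_nonneg_left (norm_integral_le_integral_norm _) (Real.exp_pos _).le).trans ?_
    rw [← integral_const_mul]
    refine le_of_eq (integral_congr_ae (ae_of_all _ fun s => ?_))
    by_cases h1 : t - s ∈ Ioo 0 T <;> by_cases h2 : s ∈ Ioo 0 T <;>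
      simp only [h1, h2, indicator_of_mem, indicator_of_notMem, not_false_eq_true, smul_eq_mul,
        norm_mul, mul_zero, zero_mul, norm_zero]
    rw [show -c * t = -c * (t - s) + -c * s by ring, Real.exp_add]
    ring
  · rw [convolution_mul]
    exact integral_nonneg fun s => mul_nonneg
      (indicator_nonneg (fun _ _ => by positivity) _) (indicator_nonneg (fun _ _ => by positivity) _)

/-- A large weight makes convolution with `γ l` a contraction, with no smallness required of `T`,
`γ` or `l`. -/
theorem exists_integral_exp_mul_norm_lt {l : ℝ → ℝ} (hl : IntegrableOn l (Ioo 0 T)) {ε : ℝ}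
    (hε : 0 < ε) : ∃ c : ℝ, 0 ≤ c ∧ ∫ t in Ioo 0 T, Real.exp (-c * t) * ‖l t‖ < ε := by
  have h : Tendsto (fun n : ℕ => ∫ t in Ioo 0 T, Real.exp (-(n : ℝ) * t) * ‖l t‖) atTop
      (𝓝 (∫ t in Ioo 0 T, (0 : ℝ))) := by
    refine tendsto_integral_of_dominated_convergence (fun t => ‖l t‖)
      (fun n => (integrableOn_exp_mul hl).aestronglyMeasurable) hl.norm (fun n => ?_) ?_
    · rw [ae_restrict_iff' measurableSet_Ioo]
      refine ae_of_all _ fun t ht => ?_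
      rw [norm_mul, norm_norm, Real.norm_eq_abs, Real.abs_exp]
      refine mul_le_of_le_one_left (norm_nonneg _) (Real.exp_le_one_iff.2 ?_)
      have := ht.1
      rw [neg_mul]; exact neg_nonpos.2 (by positivity)
    · rw [ae_restrict_iff' measurableSet_Ioo]
      refine ae_of_all _ fun t ht => ?_
      have h1 : Tendsto (fun n : ℕ => Real.exp (-(n : ℝ) * t)) atTop (𝓝 0) := by
        refine Real.tendsto_exp_atBot.comp ?_
        simp_rw [neg_mul]
        exact tendsto_neg_atTop_atBot.comp
          (tendsto_natCast_atTop_atTop.atTop_mul_const ht.1)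
      simpa using h1.mul_const ‖l t‖
  rw [integral_zero] at h
  obtain ⟨n, hn⟩ := (h.eventually_lt_const hε).exists
  exact ⟨n, n.cast_nonneg, hn⟩

/-- The terms of the Neumann series of the Volterra equation `h + γ (h ∗ l) = γ l`. -/
noncomputable def neumannTerm (γ : ℝ) (l : ℝ → ℝ) : ℕ → ℝ → ℝ
  | 0 => fun t => γ * l t
  | j + 1 => fun t => -γ * conv (neumannTerm γ l j) l t

theorem integrableOn_neumannTerm (γ : ℝ) {l : ℝ → ℝ} (hl : IntegrableOn l (Ioo 0 T)) (j : ℕ) :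
    IntegrableOn (neumannTerm γ l j) (Ioo 0 T) := by
  induction j with
  | zero => exact hl.const_mul γ
  | succ j ih => exact (integrableOn_conv ih hl).const_mul (-γ)

theorem summable_integral_norm_neumannTerm (γ : ℝ) {l : ℝ → ℝ} (hl : IntegrableOn l (Ioo 0 T)) :
    Summable fun j => ∫ t in Ioo 0 T, ‖neumannTerm γ l j t‖ := by
  -- This threshold times `|γ|` is at most `1/2`; the summand `1` keeps the denominator positive
  -- when `γ = 0`.
  obtain ⟨c, hc0, hc⟩ := exists_integral_exp_mul_norm_lt hl
    (show (0 : ℝ) < 1 / (2 * (|γ| + 1)) by positivity)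
  set A : ℕ → ℝ := fun j => ∫ t in Ioo 0 T, Real.exp (-c * t) * ‖neumannTerm γ l j t‖ with hA
  have hA0 : ∀ j, 0 ≤ A j := fun j => integral_nonneg fun t => by positivity
  have hstep : ∀ j, A (j + 1) ≤ 2⁻¹ * A j := by
    intro j
    have h1 := integral_exp_mul_norm_conv_le c (integrableOn_neumannTerm γ hl j) hl
    have h2 : A (j + 1) =
        |γ| * ∫ t in Ioo 0 T, Real.exp (-c * t) * ‖conv (neumannTerm γ l j) l t‖ := by
      rw [← integral_const_mul]
      refine integral_congr_ae (ae_of_all _ fun t => ?_)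
      simp only [neumannTerm, norm_mul, norm_neg, Real.norm_eq_abs]
      ring
    rw [h2]
    calc _ ≤ |γ| * (A j * (1 / (2 * (|γ| + 1)))) := by
          refine mul_le_mul_of_nonneg_left (h1.trans ?_) (abs_nonneg _)
          exact mul_le_mul_of_nonneg_left hc.le (hA0 j)
      _ = (|γ| / (|γ| + 1)) * (2⁻¹ * A j) := by field_simp
      _ ≤ 1 * (2⁻¹ * A j) := by
          have := hA0 j
          refine mul_le_mul_of_nonneg_right ?_ (by positivity)
          rw [div_le_one (by positivity)]; linarith
      _ = _ := one_mul _
  have hgeo : ∀ j, A j ≤ A 0 * (2⁻¹) ^ j := by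
    intro j
    induction j with
    | zero => simp
    | succ j ih =>
      calc A (j + 1) ≤ 2⁻¹ * A j := hstep j
        _ ≤ 2⁻¹ * (A 0 * 2⁻¹ ^ j) := by gcongr
        _ = _ := by ring
  -- The weight is at least `exp(-cT)` on `(0, T)`, so removing it costs the factor `exp(cT)`.
  refine Summable.of_nonneg_of_le (fun j => integral_nonneg fun t => norm_nonneg _) (fun j => ?_)
    (((summable_geometric_of_lt_one (by norm_num) (by norm_num : (2⁻¹ : ℝ) < 1)).mul_left
      (A 0)).mul_left (Real.exp (c * T)))
  refine le_trans ?_ (mul_le_mul_of_nonneg_left (hgeo j) (Real.exp_pos _).le)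
  rw [hA, ← integral_const_mul]
  refine setIntegral_mono_on (integrableOn_neumannTerm γ hl j).norm
    ((integrableOn_exp_mul (integrableOn_neumannTerm γ hl j)).const_mul _) measurableSet_Ioo
    fun t ht => ?_
  rw [← mul_assoc, ← Real.exp_add]
  refine le_mul_of_one_le_left (norm_nonneg _) (Real.one_le_exp ?_)
  nlinarith [ht.2]

/-- The Neumann series converges in `L_1` of every bounded interval, and its terms do not depend on
the interval, so one function serves the whole half-line. Existence is needed because
`resolventKernel` is selected by choice. -/
theorem exists_isResolventKernel (γ : ℝ) {l : ℝ → ℝ} (hl : LocallyIntegrableOn l (Ici 0)) :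
    ∃ h, IsResolventKernel γ l h := by
  have hlI := integrableOn_Ioo_of_locallyIntegrableOn hl
  set h : ℝ → ℝ := fun t => ∑' j, neumannTerm γ l j t with hh
  have hhI : ∀ M, IntegrableOn h (Ioo 0 M) := fun M =>
    integrable_tsum_of_summable_integral_norm (fun j => integrableOn_neumannTerm γ (hlI M) j)
      (summable_integral_norm_neumannTerm γ (hlI M))
  refine ⟨h, fun x hx => ⟨Ico 0 (x + 1), ?_, ?_⟩, ?_⟩
  · rw [mem_nhdsWithin]
    exact ⟨Iio (x + 1), isOpen_Iio, by simp, fun y hy => ⟨hy.2, hy.1⟩⟩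
  · rw [integrableOn_Ico_iff_integrableOn_Ioo]; exact hhI _
  · have hU : Ioi (0 : ℝ) = ⋃ n : ℕ, Ioo 0 (n : ℝ) := by
      ext x
      simp only [mem_Ioi, mem_iUnion, mem_Ioo, exists_and_left]
      exact ⟨fun hx => ⟨hx, exists_nat_gt x⟩, fun hx => hx.1⟩
    rw [hU, ae_restrict_iUnion_iff]
    intro n
    generalize (n : ℝ) = M
    have hs := summable_integral_norm_neumannTerm γ (hlI M)
    have hSI := fun j => integrableOn_neumannTerm γ (hlI M) j
    have hae := ae_summable_of_summable_integral_norm hSI hs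
    -- Absolute summability of the convolved terms allows the sum to be taken through the
    -- convolution with `l`.
    have hsc : Summable fun j => ∫ t in Ioo 0 M,
        ‖conv (fun s => ‖neumannTerm γ l j s‖) (fun s => ‖l s‖) t‖ := by
      refine Summable.of_nonneg_of_le (fun j => integral_nonneg fun t => norm_nonneg _)
        (fun j => ?_) (hs.mul_right (∫ t in Ioo 0 M, ‖l t‖))
      simpa using integral_exp_mul_norm_conv_le 0 (hSI j).norm (hlI M).norm
    have hae2 := ae_summable_of_summable_integral_norm
      (fun j => integrableOn_conv (hSI j).norm (hlI M).norm) hsc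
    have hae3 : ∀ᵐ t ∂(volume.restrict (Ioo 0 M)), ∀ j,
        IntervalIntegrable (fun s => neumannTerm γ l j (t - s) • l s) volume 0 t :=
      ae_all_iff.2 fun j => ae_intervalIntegrable_conv (hSI j) (hlI M)
    filter_upwards [hae, hae2, hae3, ae_restrict_mem measurableSet_Ioo] with t h1 h2 h3 ht
    have h4 : HasSum (fun j => conv (neumannTerm γ l j) l t) (conv h l t) := by
      have := hasSum_integral_of_summable_integral_norm (μ := volume.restrict (Ioo 0 t))
        (F := fun j s => neumannTerm γ l j (t - s) • l s)
        (fun j => (intervalIntegrable_iff_integrableOn_Ioo_of_le ht.1.le).1 (h3 j)) (by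
          refine h2.congr fun j => ?_
          rw [conv_eq_setIntegral _ _ ht.1.le, Real.norm_of_nonneg]
          · simp
          · exact integral_nonneg fun s => by simp only [smul_eq_mul]; positivity)
      simp_rw [conv_eq_setIntegral _ _ ht.1.le]
      simp only [smul_eq_mul, tsum_mul_right] at this ⊢
      exact this
    have h5 : h t = neumannTerm γ l 0 t + ∑' j, neumannTerm γ l (j + 1) t :=
      h1.of_norm.tsum_eq_zero_add
    have h6 : ∑' j, neumannTerm γ l (j + 1) t = -γ * conv h l t :=
      (h4.mul_left (-γ)).tsum_eq
    rw [h5, h6]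
    simp only [neumannTerm]
    ring

theorem isResolventKernel_resolventKernel (γ : ℝ) {l : ℝ → ℝ}
    (hl : LocallyIntegrableOn l (Ici 0)) : IsResolventKernel γ l (resolventKernel γ l) :=
  Classical.epsilon_spec (exists_isResolventKernel γ hl)

/-- Convolution with the resolvent kernel of `γ l` is injective if `k ∗ l = 1`. -/
theorem IsResolventKernel.ae_eq_zero_of_conv_eq_zero {k l h w : ℝ → ℝ} {γ : ℝ}
    (hh : IsResolventKernel γ l h) (hγ : γ ≠ 0) (hkl : IsPCPair k l) (hT : 0 < T)
    (hw : IntegrableOn w (Ioo 0 T))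
    (h0 : ∀ᵐ t ∂(volume.restrict (Ioo 0 T)), conv h w t = 0) :
    ∀ᵐ t ∂(volume.restrict (Ioo 0 T)), w t = 0 := by
  have hkI := integrableOn_Ioo_of_locallyIntegrableOn hkl.locallyIntegrable_left T
  have hlI := integrableOn_Ioo_of_locallyIntegrableOn hkl.locallyIntegrable_right T
  have hhI := integrableOn_Ioo_of_locallyIntegrableOn hh.locallyIntegrable T
  have hres : volume.restrict (Ioo 0 T) ≤ volume.restrict (Ioi (0 : ℝ)) :=
    Measure.restrict_mono_set _ Ioo_subset_Ioi_self
  -- Convolving the Volterra equation with `w` gives `h ∗ w + γ l ∗ (h ∗ w) = γ l ∗ w`. The left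
  -- side vanishes, hence `l ∗ w = 0`, and a further convolution with `k` gives `1 ∗ w = 0`.
  have hlw : ∀ᵐ t ∂(volume.restrict (Ioo 0 T)), conv l w t = 0 := by
    have e1 : ∀ᵐ t ∂(volume.restrict (Ioo 0 T)), conv (conv l h) w t = 0 := by
      filter_upwards [conv_assoc hlI hhI hw, ae_restrict_mem measurableSet_Ioo] with t h1 ht
      rw [h1, conv_congr (T := T) (EventuallyEq.refl _ l) h0 ht]
      simp [conv]
    filter_upwards [conv_sub hw (hlI.const_mul γ) ((integrableOn_conv hhI hlI).const_mul γ),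
      ae_restrict_mem measurableSet_Ioo, h0, e1] with t h1 ht h0t e1t
    have h2 : conv w h t = conv w (fun s => γ * l s - γ * conv h l s) t := by
      refine conv_congr (T := T) (EventuallyEq.refl _ w) ?_ ht
      filter_upwards [ae_mono hres hh.volterra] with s hs
      linarith
    have h3 := conv_const_smul w γ l t
    have h4 := conv_const_smul w γ (conv h l) t
    simp only [smul_eq_mul] at h3 h4
    rw [h1, h3, h4, conv_comm w h, h0t, conv_comm w (conv h l), funext (conv_comm h l), e1t,
      conv_comm w l] at h2
    simpa [hγ] using h2.symm
  refine ae_eq_zero_of_conv_one_eq_zero hT hw ?_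
  filter_upwards [conv_assoc hkI hlI hw, ae_restrict_mem measurableSet_Ioo] with t h1 ht
  rw [← conv_congr (T := T) (ae_mono hres hkl.conv_eq_one) (EventuallyEq.refl _ w) ht, h1,
    conv_congr (T := T) (EventuallyEq.refl _ k) hlw ht]
  simp [conv]

end Resolvent

/-! ### Positivity of `∫ ⟨1 ∗ r, k ∗ r⟩` for nonincreasing `k`. -/

section Positivity

/-- A superlevel set of a nonincreasing function is, up to an endpoint, an initial interval `(0, ρ)`
with `ρ` its supremum. -/
theorem setIntegral_superlevel_nonneg {T : ℝ} {k c : ℝ → ℝ} (hk : AntitoneOn k (Ioo 0 T))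
    (hm : ∀ ρ ∈ Icc 0 T, 0 ≤ ∫ s in Ioo 0 ρ, c s) (y : ℝ) :
    0 ≤ ∫ s in Ioo 0 T ∩ {s | y < k s}, c s := by
  rcases (Ioo 0 T ∩ {s | y < k s}).eq_empty_or_nonempty with h | ⟨a, ha⟩
  · simp [h]
  set A := Ioo 0 T ∩ {s | y < k s} with hA
  have hbdd : BddAbove A := ⟨T, fun s hs => hs.1.2.le⟩
  set ρ := sSup A
  have h1 : A ⊆ Ioc 0 ρ := fun s hs => ⟨hs.1.1, le_csSup hbdd hs⟩
  have hρT : ρ ≤ T := csSup_le ⟨a, ha⟩ fun s hs => hs.1.2.le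
  have h2 : Ioo 0 ρ ⊆ A := by
    intro s hs
    obtain ⟨b, hb, hsb⟩ := exists_lt_of_lt_csSup ⟨a, ha⟩ hs.2
    have hsI : s ∈ Ioo 0 T := ⟨hs.1, hsb.trans hb.1.2⟩
    exact ⟨hsI, hb.2.trans_le (hk hsI hb.1 hsb.le)⟩
  have h3 : A =ᵐ[volume] Ioo 0 ρ :=
    (h1.eventuallyLE.trans Ioo_ae_eq_Ioc.symm.le).antisymm h2.eventuallyLE
  rw [setIntegral_congr_set h3]
  exact hm ρ ⟨ha.1.1.le.trans (le_csSup hbdd ha), hρT⟩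

/-- If all initial integrals of `c` are nonnegative and `k` is nonnegative and nonincreasing,
then `∫ k c ≥ 0`. -/
theorem setIntegral_mul_nonneg_of_antitoneOn {T : ℝ} {k c : ℝ → ℝ} (hk : AntitoneOn k (Ioo 0 T))
    (hk0 : ∀ t ∈ Ioo 0 T, 0 ≤ k t) (hc : IntegrableOn c (Ioo 0 T))
    (hkc : IntegrableOn (fun t => k t * c t) (Ioo 0 T))
    (hm : ∀ ρ ∈ Icc 0 T, 0 ≤ ∫ s in Ioo 0 ρ, c s) : 0 ≤ ∫ t in Ioo 0 T, k t * c t := by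
  have hkm : AEMeasurable k (volume.restrict (Ioo 0 T)) :=
    aemeasurable_restrict_of_antitoneOn measurableSet_Ioo hk
  -- Layer-cake representation: `k(t)` is the length of `{y > 0 : y < k(t)}`. Fubini then reduces
  -- the claim to integrals of `c` over superlevel sets of `k`.
  set P : ℝ × ℝ → ℝ := {p : ℝ × ℝ | p.2 < k p.1}.indicator fun p => c p.1 with hP
  have hS : NullMeasurableSet {p : ℝ × ℝ | p.2 < k p.1}
      ((volume.restrict (Ioo 0 T)).prod (volume.restrict (Ioi 0))) :=
    nullMeasurableSet_lt measurable_snd.aemeasurable hkm.comp_fst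
  have hPm : AEStronglyMeasurable P
      ((volume.restrict (Ioo 0 T)).prod (volume.restrict (Ioi 0))) :=
    hc.aestronglyMeasurable.comp_fst.indicator₀ hS
  have hPt : ∀ t, (fun y => P (t, y)) = (Iio (k t)).indicator fun _ => c t := by
    intro t; ext y
    simp [hP, indicator_apply]
  have hv : ∀ t ∈ Ioo 0 T, (volume.restrict (Ioi 0)).real (Iio (k t)) = k t := by
    intro t ht
    rw [measureReal_restrict_apply measurableSet_Iio, inter_comm, Ioi_inter_Iio,
      Real.volume_real_Ioo_of_le (hk0 t ht), sub_zero]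
  have hfin : ∀ t, (volume.restrict (Ioi (0 : ℝ))) (Iio (k t)) ≠ ⊤ := by
    intro t
    rw [Measure.restrict_apply measurableSet_Iio, inter_comm, Ioi_inter_Iio]
    exact measure_Ioo_lt_top.ne
  have hPI : Integrable P ((volume.restrict (Ioo 0 T)).prod (volume.restrict (Ioi 0))) := by
    rw [integrable_prod_iff hPm]
    refine ⟨ae_of_all _ fun t => ?_, ?_⟩
    · rw [hPt t, integrable_indicator_iff measurableSet_Iio]
      exact integrableOn_const (hfin t)
    · refine hkc.norm.congr ?_
      rw [EventuallyEq, ae_restrict_iff' measurableSet_Ioo]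
      refine ae_of_all _ fun t ht => ?_
      have : (fun y => ‖P (t, y)‖) = (Iio (k t)).indicator fun _ => ‖c t‖ := by
        ext y
        rw [show P (t, y) = (Iio (k t)).indicator (fun _ => c t) y from congrFun (hPt t) y,
          norm_indicator_eq_indicator_norm]
      rw [this, integral_indicator_const _ measurableSet_Iio, hv t ht, smul_eq_mul, norm_mul,
        Real.norm_of_nonneg (hk0 t ht)]
  have e1 : ∫ t in Ioo 0 T, k t * c t = ∫ t in Ioo 0 T, ∫ y in Ioi 0, P (t, y) := by
    refine setIntegral_congr_fun measurableSet_Ioo fun t ht => ?_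
    rw [hPt t, integral_indicator_const _ measurableSet_Iio, hv t ht, smul_eq_mul]
  rw [e1, integral_integral_swap (f := fun t y => P (t, y)) hPI]
  refine integral_nonneg_of_ae ?_
  refine ae_of_all _ fun y => ?_
  have hn : NullMeasurableSet {s | y < k s} (volume.restrict (Ioo 0 T)) :=
    nullMeasurableSet_lt aemeasurable_const hkm
  have : (fun t => P (t, y)) = {s | y < k s}.indicator c := by
    ext t; simp [hP, indicator_apply]
  simp only [Pi.zero_apply]
  rw [this, integral_indicator₀ hn, Measure.restrict_restrict₀ hn, inter_comm]
  exact setIntegral_superlevel_nonneg hk hm y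

variable {F : Type*} [NormedAddCommGroup F] [InnerProductSpace ℝ F] {T : ℝ}

theorem integrable_inner_convolution_integrand {W r : ℝ → F} {κ : ℝ → ℝ} {C : ℝ}
    (hW : AEStronglyMeasurable W volume) (hWC : ∀ t, ‖W t‖ ≤ C) (hκ : Integrable κ volume)
    (hr : Integrable r volume) :
    Integrable (fun p : ℝ × ℝ => inner ℝ (W p.1) (κ p.2 • r (p.1 - p.2)))
      (volume.prod volume) := by
  have h := hκ.convolution_integrand (ContinuousLinearMap.lsmul ℝ ℝ) hr
  simp only [ContinuousLinearMap.lsmul_apply] at h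
  refine (h.norm.const_mul C).mono' (hW.comp_fst.inner h.aestronglyMeasurable)
    (ae_of_all _ fun p => ?_)
  exact (norm_inner_le_norm _ _).trans (mul_le_mul_of_nonneg_right (hWC _) (norm_nonneg _))

theorem integral_inner_convolution_eq [CompleteSpace F] {W r : ℝ → F} {κ : ℝ → ℝ} {C : ℝ}
    (hW : AEStronglyMeasurable W volume) (hWC : ∀ t, ‖W t‖ ≤ C) (hκ : Integrable κ volume)
    (hr : Integrable r volume) :
    ∫ t, inner ℝ (W t) (∫ τ, κ τ • r (t - τ)) =
      ∫ τ, κ τ * ∫ t, inner ℝ (W t) (r (t - τ)) := by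
  have hex := hκ.ae_convolution_exists (ContinuousLinearMap.lsmul ℝ ℝ) hr
  have hI := integrable_inner_convolution_integrand hW hWC hκ hr
  calc _ = ∫ t, ∫ τ, inner ℝ (W t) (κ τ • r (t - τ)) := by
        refine integral_congr_ae ?_
        filter_upwards [hex] with t ht
        exact (integral_inner ht (W t)).symm
    _ = ∫ τ, ∫ t, inner ℝ (W t) (κ τ • r (t - τ)) := integral_integral_swap hI
    _ = _ := by
        refine integral_congr_ae (ae_of_all _ fun τ => ?_)
        simp_rw [inner_smul_right]
        exact integral_const_mul _ _

/-- Pointwise `2⟨V, V - W⟩ ≥ |V|² - |W|²`. For the shift `W = V(· - ρ)` the integral of `|W|²` over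
`(0, T)` is that of `|V|²` over `(0, T - ρ)`, which is no larger than over `(0, T)`. -/
theorem setIntegral_inner_sub_shift_nonneg {V : ℝ → F} (hV : Continuous V)
    (h0 : ∀ t ≤ 0, V t = 0) {ρ : ℝ} (hρ : ρ ∈ Icc 0 T) :
    0 ≤ ∫ t in Ioo 0 T, inner ℝ (V t) (V t - V (t - ρ)) := by
  have hT : 0 ≤ T := hρ.1.trans hρ.2
  rw [← integral_Ioc_eq_integral_Ioo, ← intervalIntegral.integral_of_le hT]
  have hc1 : Continuous fun t => ‖V t‖ ^ 2 := by fun_prop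
  have hc2 : Continuous fun t => ‖V (t - ρ)‖ ^ 2 := by fun_prop
  have e1 : ∫ t in (0 : ℝ)..T, ‖V (t - ρ)‖ ^ 2 ≤ ∫ t in (0 : ℝ)..T, ‖V t‖ ^ 2 := by
    rw [intervalIntegral.integral_comp_sub_right (fun t => ‖V t‖ ^ 2) ρ,
      ← intervalIntegral.integral_add_adjacent_intervals (b := 0)
        (hc1.intervalIntegrable _ _) (hc1.intervalIntegrable _ _),
      ← intervalIntegral.integral_add_adjacent_intervals (a := 0) (b := T - ρ) (c := T)
        (hc1.intervalIntegrable _ _) (hc1.intervalIntegrable _ _)]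
    have h1 : ∫ t in (0 - ρ)..0, ‖V t‖ ^ 2 = 0 := by
      rw [intervalIntegral.integral_congr (g := fun _ => (0 : ℝ)) fun t ht => ?_]
      · simp
      · rw [uIcc_of_le (by linarith [hρ.1])] at ht
        simp [h0 t ht.2]
    have h2 : 0 ≤ ∫ t in (T - ρ)..T, ‖V t‖ ^ 2 :=
      intervalIntegral.integral_nonneg (by linarith [hρ.1]) fun _ _ => by positivity
    linarith
  have e2 : ∫ t in (0 : ℝ)..T, (2⁻¹ * ‖V t‖ ^ 2 - 2⁻¹ * ‖V (t - ρ)‖ ^ 2) ≤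
      ∫ t in (0 : ℝ)..T, inner ℝ (V t) (V t - V (t - ρ)) := by
    refine intervalIntegral.integral_mono_on hT ?_ ?_ fun t _ => ?_
    · exact Continuous.intervalIntegrable (by fun_prop) _ _
    · exact Continuous.intervalIntegrable (by fun_prop) _ _
    · rw [inner_sub_right, real_inner_self_eq_norm_sq]
      nlinarith [real_inner_le_norm (V t) (V (t - ρ)), sq_nonneg (‖V t‖ - ‖V (t - ρ)‖)]
  rw [intervalIntegral.integral_sub ((hc1.const_mul _).intervalIntegrable _ _)
    ((hc2.const_mul _).intervalIntegrable _ _), intervalIntegral.integral_const_mul,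
    intervalIntegral.integral_const_mul] at e2
  linarith

/-- For a nonnegative nonincreasing kernel `k`, one has `∫ ⟨1 ∗ r, k ∗ r⟩ ≥ 0`. -/
theorem setIntegral_inner_conv_nonneg [CompleteSpace F] {k : ℝ → ℝ} {r : ℝ → F} (hk : AntitoneOn k (Ioo 0 T))
    (hk0 : ∀ t ∈ Ioo 0 T, 0 ≤ k t) (hkI : IntegrableOn k (Ioo 0 T))
    (hr : IntegrableOn r (Ioo 0 T)) :
    0 ≤ ∫ t in Ioo 0 T, inner ℝ (conv (fun _ => 1) r t) (conv k r t) := by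
  set r' := (Ioo 0 T).indicator r with hr'
  have hrI : Integrable r' := hr.integrable_indicator measurableSet_Ioo
  set V : ℝ → F := fun t => ∫ s in (0 : ℝ)..t, r' s with hV
  have hVc : Continuous V := intervalIntegral.continuous_primitive
    (fun a b => hrI.intervalIntegrable) 0
  have hV0 : ∀ t ≤ 0, V t = 0 := by
    intro t ht
    simp only [hV]
    rw [intervalIntegral.integral_congr (g := fun _ => (0 : F)) fun s hs => ?_]
    · simp
    · rw [uIcc_of_ge ht] at hs
      exact indicator_of_notMem (fun h => absurd h.1 (not_lt.2 hs.2)) _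
  have hVC : ∀ t, ‖V t‖ ≤ ∫ s, ‖r' s‖ := by
    intro t
    refine intervalIntegral.norm_integral_le_integral_norm_uIoc.trans ?_
    exact setIntegral_le_integral hrI.norm (ae_of_all _ fun _ => norm_nonneg _)
  set W : ℝ → F := (Ioo 0 T).indicator V with hW
  have hWm : AEStronglyMeasurable W volume := hVc.aestronglyMeasurable.indicator measurableSet_Ioo
  have hWC : ∀ t, ‖W t‖ ≤ ∫ s, ‖r' s‖ := fun t => (norm_indicator_le_norm_self _ _).trans (hVC t)
  -- With this correlation function the form is `∫ κ c`, linear in the kernel `κ`, so it suffices to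
  -- examine indicators of `(0, ρ)`.
  set c : ℝ → ℝ := fun τ => ∫ t, inner ℝ (W t) (r' (t - τ)) with hc
  have hint : ∀ {κ : ℝ → ℝ}, Integrable κ → Integrable fun τ => κ τ * c τ := by
    intro κ hκ
    have := (integrable_inner_convolution_integrand hWm hWC hκ hrI).integral_prod_right
    simpa only [inner_smul_right, integral_const_mul] using this
  have hQ : ∀ {κ : ℝ → ℝ}, Integrable κ →
      ∫ t in Ioo 0 T, inner ℝ (V t) (∫ τ, κ τ • r' (t - τ)) = ∫ τ, κ τ * c τ := by
    intro κ hκ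
    rw [← integral_inner_convolution_eq hWm hWC hκ hrI, ← integral_indicator measurableSet_Ioo]
    refine integral_congr_ae (ae_of_all _ fun t => ?_)
    by_cases ht : t ∈ Ioo 0 T <;> simp [hW, ht]
  have hind : ∀ (κ : ℝ → ℝ) (ρ : ℝ), (fun τ => (Ioo 0 ρ).indicator κ τ * c τ) =
      (Ioo 0 ρ).indicator fun τ => κ τ * c τ := by
    intro κ ρ; ext τ
    by_cases h : τ ∈ Ioo 0 ρ <;> simp [h]
  have h1I : ∀ ρ : ℝ, Integrable ((Ioo 0 ρ).indicator fun _ : ℝ => (1 : ℝ)) := fun ρ =>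
    (integrableOn_const measure_Ioo_lt_top.ne).integrable_indicator measurableSet_Ioo
  have hcI : IntegrableOn c (Ioo 0 T) := by
    have := hint (h1I T)
    rw [hind] at this
    simpa using (integrable_indicator_iff measurableSet_Ioo).1 this
  have hkcI : IntegrableOn (fun t => k t * c t) (Ioo 0 T) := by
    have := hint (hkI.integrable_indicator measurableSet_Ioo)
    rw [hind] at this
    exact (integrable_indicator_iff measurableSet_Ioo).1 this
  -- For the kernel `1_(0,ρ)` the convolution with `r'` is `V(t) - V(t - ρ)`.
  have hm : ∀ ρ ∈ Icc 0 T, 0 ≤ ∫ s in Ioo 0 ρ, c s := by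
    intro ρ hρ
    have h1 := hQ (h1I ρ)
    rw [hind, integral_indicator measurableSet_Ioo] at h1
    simp only [one_mul] at h1
    rw [← h1]
    refine (setIntegral_inner_sub_shift_nonneg hVc hV0 hρ).trans_eq ?_
    refine setIntegral_congr_fun measurableSet_Ioo fun t _ => ?_
    congr 1
    have h2 : ∀ τ, (Ioo 0 ρ).indicator (fun _ => (1 : ℝ)) τ • r' (t - τ) =
        (Ioo 0 ρ).indicator (fun τ => r' (t - τ)) τ := by
      intro τ
      by_cases h : τ ∈ Ioo 0 ρ <;> simp [h]
    simp_rw [h2]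
    rw [integral_indicator measurableSet_Ioo, ← integral_Ioc_eq_integral_Ioo,
      ← intervalIntegral.integral_of_le hρ.1, intervalIntegral.integral_comp_sub_left, sub_zero]
    exact intervalIntegral.integral_interval_sub_left hrI.intervalIntegrable
      hrI.intervalIntegrable
  have hfin := setIntegral_mul_nonneg_of_antitoneOn hk hk0 hcI hkcI hm
  rw [← integral_indicator measurableSet_Ioo, ← hind, ← hQ (hkI.integrable_indicator
    measurableSet_Ioo)] at hfin
  refine hfin.trans_eq (setIntegral_congr_fun measurableSet_Ioo fun t ht => ?_)
  have h1 : V t = conv (fun _ => 1) r t := by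
    rw [conv_one]
    refine intervalIntegral.integral_congr_ae (ae_of_all _ fun s hs => ?_)
    rw [uIoc_of_le ht.1.le] at hs
    exact indicator_of_mem (show s ∈ Ioo 0 T from ⟨hs.1, hs.2.trans_lt ht.2⟩) _
  rw [h1, conv_eq_convolution k r ht, convolution_lsmul]

end Positivity

/-! ### Convolution in time of functions on space-time. -/

section Parametric

/-- The domain of integration no longer depends on `t`, as Fubini on a product measure requires. -/
theorem conv_eq_setIntegral_indicator {F : Type*} [NormedAddCommGroup F] [NormedSpace ℝ F] {T t : ℝ}
    (k : ℝ → ℝ) (v : ℝ → F) (ht : t ∈ Ioo 0 T) :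
    conv k v t = ∫ s in Ioo 0 T, (Ioo 0 T).indicator k (t - s) • v s := by
  rw [conv_eq_integral k v ht, ← integral_indicator measurableSet_Ioo]
  refine integral_congr_ae (ae_of_all _ fun s => ?_)
  by_cases hs : s ∈ Ioo 0 T <;> simp [hs]

theorem ae_ae_swap_of_ae_prod {Y X : Type*} [MeasurableSpace Y] [MeasurableSpace X]
    {ν : Measure Y} {μ : Measure X} [SFinite μ] [SFinite ν] {P : Y × X → Prop}
    (h : ∀ᵐ p ∂(ν.prod μ), P p) : ∀ᵐ x ∂μ, ∀ᵐ t ∂ν, P (t, x) :=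
  Measure.ae_ae_of_ae_prod
    ((Measure.measurePreserving_swap (μ := μ) (ν := ν)).quasiMeasurePreserving.ae h)

theorem ae_mem_Ioo_prod {X : Type*} [MeasurableSpace X] {μ : Measure X} {T : ℝ} : ∀ᵐ p ∂((volume.restrict (Ioo 0 T)).prod μ), p.1 ∈ Ioo 0 T :=
  Measure.quasiMeasurePreserving_fst.ae (ae_restrict_mem measurableSet_Ioo)

theorem ae_slice_integrableOn {X F : Type*} [MeasurableSpace X] {μ : Measure X} [SFinite μ]
    [NormedAddCommGroup F] {T : ℝ} {w : ℝ × X → F}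
    (hw : Integrable w ((volume.restrict (Ioo 0 T)).prod μ)) :
    ∀ᵐ x ∂μ, IntegrableOn (fun t => w (t, x)) (Ioo 0 T) :=
  hw.prod_left_ae

theorem ae_prod_of_ae_snd {Y X : Type*} [MeasurableSpace Y] [MeasurableSpace X] {μ : Measure X} {ν : Measure Y}
    {P : X → Prop} (h : ∀ᵐ x ∂μ, P x) : ∀ᵐ p ∂(ν.prod μ), P p.2 :=
  Measure.quasiMeasurePreserving_snd.ae h

/-- Convolution in time of a kernel with a function on space-time. -/
noncomputable def timeConv {X F : Type*} [NormedAddCommGroup F] [NormedSpace ℝ F]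
    (k : ℝ → ℝ) (w : ℝ × X → F) (p : ℝ × X) : F :=
  conv k (fun τ => w (τ, p.2)) p.1

theorem ae_timeConv_eq {X F : Type*} [MeasurableSpace X] {μ : Measure X}
    [NormedAddCommGroup F] [NormedSpace ℝ F] {T : ℝ} (k : ℝ → ℝ) (w : ℝ × X → F) :
    ∀ᵐ p ∂((volume.restrict (Ioo 0 T)).prod μ), timeConv k w p =
      ∫ s in Ioo 0 T, (Ioo 0 T).indicator k (p.1 - s) • w (s, p.2) := by
  filter_upwards [ae_mem_Ioo_prod] with p hp
  exact conv_eq_setIntegral_indicator k _ hp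

variable {X : Type*} [MeasurableSpace X] {μ : Measure X} [SFinite μ]
  {F : Type*} [NormedAddCommGroup F] [NormedSpace ℝ F] {T : ℝ}

/-- The integrand is the tensor product of `k` and `w` composed with the measure-preserving shear
`((s, x), t) ↦ ((s, x), t - s)`. -/
theorem integrable_timeConv_integrand {k : ℝ → ℝ} {w : ℝ × X → F} (hk : IntegrableOn k (Ioo 0 T))
    (hw : Integrable w ((volume.restrict (Ioo 0 T)).prod μ)) :
    Integrable (fun z : (ℝ × X) × ℝ => (Ioo 0 T).indicator k (z.2 - z.1.1) • w z.1)
      (((volume.restrict (Ioo 0 T)).prod μ).prod (volume.restrict (Ioo 0 T))) := by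
  have h1 : Integrable (fun z : (ℝ × X) × ℝ => (Ioo 0 T).indicator k z.2 • w z.1)
      (((volume.restrict (Ioo 0 T)).prod μ).prod volume) :=
    ((hk.integrable_indicator measurableSet_Ioo).smul_prod hw).swap
  have h2 : MeasurePreserving (fun z : (ℝ × X) × ℝ => (z.1, z.2 - z.1.1))
      (((volume.restrict (Ioo 0 T)).prod μ).prod volume)
      (((volume.restrict (Ioo 0 T)).prod μ).prod volume) :=
    (MeasurePreserving.id _).skew_product (g := fun (q : ℝ × X) (t : ℝ) => t - q.1) (by fun_prop)
      (ae_of_all _ fun q => (measurePreserving_sub_right volume q.1).map_eq)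
  have h3 := h2.integrable_comp_of_integrable h1
  refine Integrable.mono_measure h3 ?_
  exact Measure.prod_mono le_rfl Measure.restrict_le_self

theorem measurePreserving_swap_time {ν : Measure ℝ} [SFinite ν] :
    MeasurePreserving (fun z : (ℝ × X) × ℝ => ((z.2, z.1.2), z.1.1))
      ((ν.prod μ).prod ν) ((ν.prod μ).prod ν) :=
  Measure.measurePreserving_swap.comp
    (((MeasurePreserving.id ν).prod Measure.measurePreserving_swap).comp
      (measurePreserving_prodAssoc ν μ ν))

theorem integrable_timeConv_integrand_swap {k : ℝ → ℝ} {w : ℝ × X → F}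
    (hk : IntegrableOn k (Ioo 0 T)) (hw : Integrable w ((volume.restrict (Ioo 0 T)).prod μ)) :
    Integrable (fun z : (ℝ × X) × ℝ => (Ioo 0 T).indicator k (z.1.1 - z.2) • w (z.2, z.1.2))
      (((volume.restrict (Ioo 0 T)).prod μ).prod (volume.restrict (Ioo 0 T))) :=
  measurePreserving_swap_time.integrable_comp_of_integrable (integrable_timeConv_integrand hk hw)

theorem integrable_timeConv {k : ℝ → ℝ} {w : ℝ × X → F} (hk : IntegrableOn k (Ioo 0 T))
    (hw : Integrable w ((volume.restrict (Ioo 0 T)).prod μ)) :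
    Integrable (timeConv k w) ((volume.restrict (Ioo 0 T)).prod μ) :=
  (integrable_timeConv_integrand_swap hk hw).integral_prod_left.congr
    ((ae_timeConv_eq k w).mono fun _ h => h.symm)

theorem timeConv_congr {k k' : ℝ → ℝ} {w w' : ℝ × X → F}
    (hk : k =ᵐ[volume.restrict (Ioo 0 T)] k')
    (hw : w =ᵐ[(volume.restrict (Ioo 0 T)).prod μ] w') :
    timeConv k w =ᵐ[(volume.restrict (Ioo 0 T)).prod μ] timeConv k' w' := by
  filter_upwards [ae_mem_Ioo_prod, ae_prod_of_ae_snd (ae_ae_swap_of_ae_prod hw)] with p hp h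
  exact conv_congr hk h hp

theorem ae_setIntegral_integrable {k : ℝ → ℝ} {w : ℝ × X → F} (hk : IntegrableOn k (Ioo 0 T))
    (hw : Integrable w ((volume.restrict (Ioo 0 T)).prod μ)) :
    ∀ᵐ p ∂((volume.restrict (Ioo 0 T)).prod μ),
      IntegrableOn (fun s => (Ioo 0 T).indicator k (p.1 - s) • w (s, p.2)) (Ioo 0 T) :=
  (integrable_timeConv_integrand_swap hk hw).prod_right_ae

theorem timeConv_add {k : ℝ → ℝ} {v w : ℝ × X → F} (hk : IntegrableOn k (Ioo 0 T))
    (hv : Integrable v ((volume.restrict (Ioo 0 T)).prod μ))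
    (hw : Integrable w ((volume.restrict (Ioo 0 T)).prod μ)) :
    timeConv k (fun p => v p + w p) =ᵐ[(volume.restrict (Ioo 0 T)).prod μ]
      fun p => timeConv k v p + timeConv k w p := by
  filter_upwards [ae_timeConv_eq (T := T) k v, ae_timeConv_eq k w,
    ae_timeConv_eq k (fun p => v p + w p), ae_setIntegral_integrable hk hv,
    ae_setIntegral_integrable hk hw] with p h1 h2 h3 h4 h5
  rw [h1, h2, h3, ← integral_add h4 h5]
  simp_rw [smul_add]

theorem timeConv_sub {k : ℝ → ℝ} {v w : ℝ × X → F} (hk : IntegrableOn k (Ioo 0 T))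
    (hv : Integrable v ((volume.restrict (Ioo 0 T)).prod μ))
    (hw : Integrable w ((volume.restrict (Ioo 0 T)).prod μ)) :
    timeConv k (fun p => v p - w p) =ᵐ[(volume.restrict (Ioo 0 T)).prod μ]
      fun p => timeConv k v p - timeConv k w p := by
  filter_upwards [ae_timeConv_eq (T := T) k v, ae_timeConv_eq k w,
    ae_timeConv_eq k (fun p => v p - w p), ae_setIntegral_integrable hk hv,
    ae_setIntegral_integrable hk hw] with p h1 h2 h3 h4 h5
  rw [h1, h2, h3, ← integral_sub h4 h5]
  simp_rw [smul_sub]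

/-- Convolution in time commutes with integration in space. -/
theorem ae_integral_timeConv [CompleteSpace F] {k : ℝ → ℝ} {w : ℝ × X → F}
    (hk : IntegrableOn k (Ioo 0 T))
    (hw : Integrable w ((volume.restrict (Ioo 0 T)).prod μ)) :
    ∀ᵐ t ∂(volume.restrict (Ioo 0 T)),
      ∫ x, timeConv k w (t, x) ∂μ = conv k (fun s => ∫ x, w (s, x) ∂μ) t := by
  filter_upwards [(integrable_timeConv_integrand hk hw).prod_left_ae,
    ae_restrict_mem measurableSet_Ioo] with t h ht
  rw [conv_eq_setIntegral_indicator _ _ ht]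
  simp_rw [← integral_smul]
  rw [integral_integral_swap h]
  exact integral_congr_ae (ae_of_all _ fun x => conv_eq_setIntegral_indicator k _ ht)

theorem integral_timeConv_norm_le {k : ℝ → ℝ} {w : ℝ × X → ℝ} (hk : IntegrableOn k (Ioo 0 T))
    (hw : Integrable w ((volume.restrict (Ioo 0 T)).prod μ)) (hw0 : ∀ p, 0 ≤ w p) :
    ∫ p, timeConv (fun t => ‖k t‖) w p ∂((volume.restrict (Ioo 0 T)).prod μ) ≤
      (∫ t in Ioo 0 T, ‖k t‖) * ∫ p, w p ∂((volume.restrict (Ioo 0 T)).prod μ) := by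
  have hB := integrable_timeConv_integrand hk.norm hw
  have hB' := integrable_timeConv_integrand_swap hk.norm hw
  have hki := IntegrableOn.integrable_indicator hk.norm measurableSet_Ioo
  rw [integral_congr_ae (ae_timeConv_eq _ w)]
  have e1 := integral_prod _ hB'
  have e2 := integral_prod _ hB
  have hmp := measurePreserving_swap_time (μ := μ) (ν := volume.restrict (Ioo 0 T))
  have e3 := integral_map hmp.measurable.aemeasurable
    (by rw [hmp.map_eq]; exact hB.aestronglyMeasurable)
  rw [hmp.map_eq] at e3
  rw [← e1, ← e3, e2, ← integral_const_mul]
  refine integral_mono_ae hB.integral_prod_left (hw.const_mul _) (ae_of_all _ fun q => ?_)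
  simp only [smul_eq_mul, integral_mul_const]
  refine mul_le_mul_of_nonneg_right ?_ (hw0 q)
  refine (setIntegral_le_integral (hki.comp_sub_right q.1) (ae_of_all _ fun t => ?_)).trans ?_
  · exact indicator_nonneg (fun _ _ => norm_nonneg _) _
  · rw [integral_sub_right_eq_self (fun t => (Ioo 0 T).indicator (fun t => ‖k t‖) t) q.1,
      integral_indicator measurableSet_Ioo]

/-- Weighted Cauchy–Schwarz: the quadratic polynomial `c ↦ ∫ a (c - b)²` is nonnegative, so its
discriminant is not positive. -/
theorem sq_integral_mul_le {Y : Type*} [MeasurableSpace Y] {ν : Measure Y} {a b : Y → ℝ}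
    (ha : ∀ y, 0 ≤ a y) (hI0 : Integrable a ν) (hI1 : Integrable (fun y => a y * b y) ν)
    (hI2 : Integrable (fun y => a y * b y ^ 2) ν) :
    (∫ y, a y * b y ∂ν) ^ 2 ≤ (∫ y, a y ∂ν) * ∫ y, a y * b y ^ 2 ∂ν := by
  have h : ∀ c : ℝ, 0 ≤ (∫ y, a y ∂ν) * (c * c) + (-2 * ∫ y, a y * b y ∂ν) * c +
      ∫ y, a y * b y ^ 2 ∂ν := by
    intro c
    have h0 : 0 ≤ ∫ y, (c * c * a y + (-2 * c) * (a y * b y)) + a y * b y ^ 2 ∂ν :=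
      integral_nonneg fun y => by
        have := mul_nonneg (ha y) (sq_nonneg (c - b y))
        simp only [Pi.zero_apply]
        nlinarith
    rw [integral_add (f := fun y => c * c * a y + (-2 * c) * (a y * b y))
        ((hI0.const_mul _).add (hI1.const_mul _)) hI2,
      integral_add (hI0.const_mul _) (hI1.const_mul _), integral_const_mul,
      integral_const_mul] at h0
    linarith
  have := discrim_le_zero h
  rw [discrim] at this
  linarith

/-- Young's inequality for `L_1 ∗ L_2`: Cauchy–Schwarz with weight `|k(t - s)|` gives `|k ∗ w|² ≤
‖k‖₁ (|k| ∗ |w|²)` almost everywhere, which is then integrated. -/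
theorem memLp_timeConv [IsFiniteMeasure μ] {k : ℝ → ℝ} {w : ℝ × X → F}
    (hk : IntegrableOn k (Ioo 0 T)) (hw : MemLp w 2 ((volume.restrict (Ioo 0 T)).prod μ)) :
    MemLp (timeConv k w) 2 ((volume.restrict (Ioo 0 T)).prod μ) ∧
      ∫ p, ‖timeConv k w p‖ ^ 2 ∂((volume.restrict (Ioo 0 T)).prod μ) ≤
        (∫ t in Ioo 0 T, ‖k t‖) ^ 2 * ∫ p, ‖w p‖ ^ 2 ∂((volume.restrict (Ioo 0 T)).prod μ) := by
  have hwI := hw.integrable one_le_two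
  have hw2 := (memLp_two_iff_integrable_sq_norm hw.aestronglyMeasurable).1 hw
  set A := ∫ t in Ioo 0 T, ‖k t‖
  have hA : 0 ≤ A := integral_nonneg fun _ => norm_nonneg _
  have hki := IntegrableOn.integrable_indicator hk.norm measurableSet_Ioo
  have hb : ∀ᵐ p ∂((volume.restrict (Ioo 0 T)).prod μ), ‖timeConv k w p‖ ^ 2 ≤
      A * timeConv (fun t => ‖k t‖) (fun p => ‖w p‖ ^ 2) p := by
    filter_upwards [ae_timeConv_eq (T := T) k w,
      ae_timeConv_eq (T := T) (fun t => ‖k t‖) (fun p => ‖w p‖ ^ 2),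
      ae_setIntegral_integrable hk.norm hwI.norm,
      ae_setIntegral_integrable hk.norm hw2] with p h1 h2 h3 h4
    rw [h1, h2]
    have hn : ‖∫ s in Ioo 0 T, (Ioo 0 T).indicator k (p.1 - s) • w (s, p.2)‖ ≤
        ∫ s in Ioo 0 T, (Ioo 0 T).indicator (fun t => ‖k t‖) (p.1 - s) * ‖w (s, p.2)‖ := by
      refine (norm_integral_le_integral_norm _).trans_eq ?_
      simp_rw [norm_smul, norm_indicator_eq_indicator_norm]
    have ha0 : ∀ s, 0 ≤ (Ioo 0 T).indicator (fun t => ‖k t‖) (p.1 - s) := fun s =>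
      indicator_nonneg (fun _ _ => norm_nonneg _) _
    have haI := hki.comp_sub_left p.1
    have hCS := sq_integral_mul_le ha0 haI.integrableOn h3 h4
    refine (pow_le_pow_left₀ (norm_nonneg _) hn 2).trans (hCS.trans ?_)
    refine mul_le_mul_of_nonneg_right ?_
      (integral_nonneg fun s => mul_nonneg (ha0 s) (by positivity))
    refine (setIntegral_le_integral haI (ae_of_all _ ha0)).trans_eq ?_
    rw [integral_sub_left_eq_self (fun t => (Ioo 0 T).indicator (fun t => ‖k t‖) t) volume p.1,
      integral_indicator measurableSet_Ioo]
  have hI2 := (integrable_timeConv hk.norm hw2).const_mul A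
  have hm := (integrable_timeConv hk hwI).aestronglyMeasurable
  have hI : Integrable (fun p => ‖timeConv k w p‖ ^ 2)
      ((volume.restrict (Ioo 0 T)).prod μ) := by
    refine hI2.mono' (hm.norm.pow 2) (hb.mono fun p hp => ?_)
    rwa [Real.norm_of_nonneg (by positivity)]
  refine ⟨(memLp_two_iff_integrable_sq_norm hm).2 hI, ?_⟩
  refine (integral_mono_ae hI hI2 hb).trans ?_
  rw [integral_const_mul, sq, mul_assoc]
  exact mul_le_mul_of_nonneg_left
    (integral_timeConv_norm_le hk hw2 fun p => by positivity) hA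

end Parametric

/-! ### Time convolution as an operator on `L_2`; positivity of `l` on antiderivatives. -/

section Operator

variable {X : Type*} [MeasurableSpace X] {μ : Measure X} [IsFiniteMeasure μ]
  {F : Type*} [NormedAddCommGroup F] [InnerProductSpace ℝ F] {T : ℝ}

/-- Convolution in time is a bounded operator on `L_2`. -/
theorem exists_clm_timeConv {k : ℝ → ℝ} (hk : IntegrableOn k (Ioo 0 T)) :
    ∃ A : Lp F 2 ((volume.restrict (Ioo 0 T)).prod μ) →L[ℝ]
        Lp F 2 ((volume.restrict (Ioo 0 T)).prod μ),
      ∀ w, A w =ᵐ[(volume.restrict (Ioo 0 T)).prod μ] timeConv k w := by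
  have hmem : ∀ w : Lp F 2 ((volume.restrict (Ioo 0 T)).prod μ),
      MemLp (timeConv k w) 2 ((volume.restrict (Ioo 0 T)).prod μ) := fun w =>
    (memLp_timeConv hk (Lp.memLp w)).1
  have hint : ∀ w : Lp F 2 ((volume.restrict (Ioo 0 T)).prod μ),
      Integrable w ((volume.restrict (Ioo 0 T)).prod μ) := fun w =>
    (Lp.memLp w).integrable one_le_two
  let L : Lp F 2 ((volume.restrict (Ioo 0 T)).prod μ) →ₗ[ℝ]
      Lp F 2 ((volume.restrict (Ioo 0 T)).prod μ) :=
    { toFun := fun w => (hmem w).toLp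
      map_add' := fun v w => by
        rw [← MemLp.toLp_add, MemLp.toLp_eq_toLp_iff]
        exact (timeConv_congr (EventuallyEq.refl _ k) (Lp.coeFn_add v w)).trans
          (timeConv_add hk (hint v) (hint w))
      map_smul' := fun c w => by
        rw [RingHom.id_apply, ← MemLp.toLp_const_smul, MemLp.toLp_eq_toLp_iff]
        refine (timeConv_congr (EventuallyEq.refl _ k) (Lp.coeFn_smul c w)).trans
          (ae_of_all _ fun p => ?_)
        exact conv_const_smul k c (fun τ => w (τ, p.2)) p.1 }
  refine ⟨L.mkContinuous (∫ t in Ioo 0 T, ‖k t‖) fun w => ?_, fun w => (hmem w).coeFn_toLp⟩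
  have hA : 0 ≤ ∫ t in Ioo 0 T, ‖k t‖ := integral_nonneg fun _ => norm_nonneg _
  refine le_of_sq_le_sq ?_ (by positivity)
  have hn : ∀ v : Lp F 2 ((volume.restrict (Ioo 0 T)).prod μ),
      ‖v‖ ^ 2 = ∫ p, ‖v p‖ ^ 2 ∂((volume.restrict (Ioo 0 T)).prod μ) := fun v => by
    rw [← real_inner_self_eq_norm_sq, L2.inner_def]
    simp_rw [real_inner_self_eq_norm_sq]
  rw [mul_pow, hn, hn]
  refine (integral_congr_ae ?_).trans_le (memLp_timeConv hk (Lp.memLp w)).2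
  filter_upwards [(hmem w).coeFn_toLp] with p hp
  exact congrArg (fun y => ‖y‖ ^ 2) hp

theorem integrable_inner_of_memLp_two {Y : Type*} [MeasurableSpace Y] {ν : Measure Y} {v w : Y → F}
    (hv : MemLp v 2 ν) (hw : MemLp w 2 ν) : Integrable (fun y => inner ℝ (v y) (w y)) ν := by
  have h := L2.integrable_inner (𝕜 := ℝ) hv.toLp hw.toLp
  refine h.congr ?_
  filter_upwards [hv.coeFn_toLp, hw.coeFn_toLp] with y h1 h2
  rw [h1, h2]

/-- On each slice set `r = l ∗ q`. Then `l ∗ (1 ∗ q) = 1 ∗ r` and `1 ∗ q = (k ∗ l) ∗ q = k ∗ r`,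
which is the form already known to be nonnegative. -/
theorem integral_inner_timeConv_one_nonneg [CompleteSpace F] {k l : ℝ → ℝ} (hkl : IsPCPair k l)
    {q : ℝ × X → F} (hq : MemLp q 2 ((volume.restrict (Ioo 0 T)).prod μ)) :
    0 ≤ ∫ p, inner ℝ (timeConv l (timeConv (fun _ => 1) q) p) (timeConv (fun _ => 1) q p)
      ∂((volume.restrict (Ioo 0 T)).prod μ) := by
  have hkI := integrableOn_Ioo_of_locallyIntegrableOn hkl.locallyIntegrable_left T
  have hlI := integrableOn_Ioo_of_locallyIntegrableOn hkl.locallyIntegrable_right T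
  have h1I : IntegrableOn (fun _ : ℝ => (1 : ℝ)) (Ioo 0 T) :=
    integrableOn_const measure_Ioo_lt_top.ne
  have hres : volume.restrict (Ioo 0 T) ≤ volume.restrict (Ioi (0 : ℝ)) :=
    Measure.restrict_mono_set _ Ioo_subset_Ioi_self
  have hJ := (memLp_timeConv h1I hq).1
  have hI := integrable_inner_of_memLp_two (memLp_timeConv hlI hJ).1 hJ
  rw [integral_prod_symm _ hI]
  refine integral_nonneg_of_ae ?_
  filter_upwards [ae_slice_integrableOn (hq.integrable one_le_two)] with x hx
  set v : ℝ → F := fun t => q (t, x)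
  have hr := integrableOn_conv hlI hx
  refine (setIntegral_inner_conv_nonneg (hkl.antitone.mono Ioo_subset_Ioi_self)
    (fun t ht => hkl.nonneg t ht.1) hkI hr).trans_eq (integral_congr_ae ?_)
  filter_upwards [conv_assoc hkI hlI hx, conv_assoc hlI h1I hx, conv_assoc h1I hlI hx,
    ae_restrict_mem measurableSet_Ioo] with t e1 e2 e3 ht
  change _ = inner ℝ (conv l (conv (fun _ => 1) v) t) (conv (fun _ => 1) v t)
  rw [← e1, ← e2, ← e3, conv_congr (T := T) (ae_mono hres hkl.conv_eq_one)
    (EventuallyEq.refl _ v) ht, funext (conv_comm l fun _ => 1)]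

end Operator

/-! ### Density of antiderivatives and positive type of `l`. -/

section Cylinder

variable {N : ℕ} {T : ℝ} {Ω : Set (EuclideanSpace ℝ (Fin N))}
  {F : Type*} [NormedAddCommGroup F] [InnerProductSpace ℝ F]

theorem volume_restrict_cylinder (T : ℝ) (Ω : Set (EuclideanSpace ℝ (Fin N))) :
    volume.restrict (cylinder T Ω) = (volume.restrict (Ioo 0 T)).prod (volume.restrict Ω) := by
  rw [cylinder, Measure.volume_eq_prod, Measure.prod_restrict]

theorem isOpen_cylinder (hΩ : IsOpen Ω) : IsOpen (cylinder T Ω) := isOpen_Ioo.prod hΩ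

theorem IsTestFunction.deriv_fst {θ : ℝ × EuclideanSpace ℝ (Fin N) → ℝ}
    (hθ : IsTestFunction (cylinder T Ω) θ) (t : ℝ) (x : EuclideanSpace ℝ (Fin N)) :
    HasDerivAt (fun s => θ (s, x)) (fderiv ℝ θ (t, x) (1, 0)) t := by
  have h1 : HasFDerivAt θ (fderiv ℝ θ (t, x)) (t, x) :=
    (hθ.smooth.differentiable (by simp)).differentiableAt.hasFDerivAt
  have h2 : HasDerivAt (fun s : ℝ => (s, x)) ((1 : ℝ), (0 : EuclideanSpace ℝ (Fin N))) t :=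
    (hasDerivAt_id t).prodMk (hasDerivAt_const t x)
  exact h1.comp_hasDerivAt t h2

/-- Antiderivatives in time are dense in `L_2(Ω_T)`: their orthogonal complement is trivial. -/
theorem ae_eq_zero_of_forall_integral_inner_timeConv_one (hΩ : IsOpen Ω) [CompleteSpace F]
    {w : ℝ × EuclideanSpace ℝ (Fin N) → F}
    (hw : MemLp w 2 ((volume.restrict (Ioo 0 T)).prod (volume.restrict Ω)))
    [IsFiniteMeasure (volume.restrict Ω)]
    (h : ∀ q : ℝ × EuclideanSpace ℝ (Fin N) → F,
      MemLp q 2 ((volume.restrict (Ioo 0 T)).prod (volume.restrict Ω)) →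
      ∫ p, inner ℝ (timeConv (fun _ => 1) q p) (w p)
        ∂((volume.restrict (Ioo 0 T)).prod (volume.restrict Ω)) = 0) :
    w =ᵐ[(volume.restrict (Ioo 0 T)).prod (volume.restrict Ω)] 0 := by
  have hwI := hw.integrable one_le_two
  rw [← volume_restrict_cylinder] at h hw hwI ⊢
  rw [EventuallyEq, ae_restrict_iff' (isOpen_cylinder hΩ).measurableSet]
  refine (isOpen_cylinder hΩ).ae_eq_zero_of_integral_contDiff_smul_eq_zero
    (IntegrableOn.locallyIntegrableOn hwI) fun θ hθ1 hθ2 hθ3 => ?_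
  have hθ : IsTestFunction (cylinder T Ω) θ := ⟨hθ1, hθ2, hθ3⟩
  have e0 : ∫ p, θ p • w p = ∫ p in cylinder T Ω, θ p • w p := by
    refine (setIntegral_eq_integral_of_forall_compl_eq_zero fun p hp => ?_).symm
    rw [image_eq_zero_of_notMem_tsupport fun hp' => hp (hθ3 hp'), zero_smul]
  rw [e0]
  obtain ⟨C, hC⟩ := hθ2.exists_bound_of_continuous hθ1.continuous
  have hθw : Integrable (fun p => θ p • w p) (volume.restrict (cylinder T Ω)) :=
    hwI.bdd_smul _ hθ1.continuous.aestronglyMeasurable (ae_of_all _ hC)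
  refine ext_inner_left ℝ fun e => ?_
  rw [inner_zero_right, ← integral_inner hθw]
  -- The choice `q = ∂_t θ · e` gives `1 ∗ q = θ e`, since `θ` vanishes at `t = 0`.
  have hq : MemLp (fun p => fderiv ℝ θ p (1, 0) • e) 2 (volume.restrict (cylinder T Ω)) := by
    have hc : Continuous fun p => fderiv ℝ θ p (1, 0) • e :=
      ((hθ1.continuous_fderiv (by simp)).clm_apply continuous_const).smul continuous_const
    refine hc.memLp_of_hasCompactSupport ?_
    refine (hθ2.fderiv ℝ).mono fun p hp => ?_
    simp only [Function.mem_support] at hp ⊢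
    intro h0; apply hp; simp [h0]
  rw [← h _ hq]
  refine setIntegral_congr_fun (isOpen_cylinder hΩ).measurableSet fun p hp => ?_
  have e1 : timeConv (fun _ => 1) (fun p => fderiv ℝ θ p (1, 0) • e) p = θ p • e := by
    rw [timeConv, conv_one, intervalIntegral.integral_smul_const]
    congr 1
    rw [intervalIntegral.integral_eq_sub_of_hasDerivAt
      (fun t _ => hθ.deriv_fst t p.2)]
    · rw [image_eq_zero_of_notMem_tsupport (x := ((0 : ℝ), p.2)) fun hp' =>
        absurd (hθ3 hp').1.1 (lt_irrefl _), sub_zero]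
    · have hc : Continuous fun t : ℝ => fderiv ℝ θ (t, p.2) (1, 0) :=
        ((hθ1.continuous_fderiv (by simp)).comp (by fun_prop)).clm_apply continuous_const
      exact hc.intervalIntegrable _ _
  simp only [e1, inner_smul_left, inner_smul_right]
  rfl

/-- The kernel `l` of a pair `(k, l) ∈ 𝒫𝒞` is of positive type. -/
theorem integral_inner_timeConv_nonneg (hΩ : IsOpen Ω) [CompleteSpace F]
    [IsFiniteMeasure (volume.restrict Ω)] {k l : ℝ → ℝ} (hkl : IsPCPair k l)
    {w : ℝ × EuclideanSpace ℝ (Fin N) → F}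
    (hw : MemLp w 2 ((volume.restrict (Ioo 0 T)).prod (volume.restrict Ω))) :
    0 ≤ ∫ p, inner ℝ (timeConv l w p) (w p)
      ∂((volume.restrict (Ioo 0 T)).prod (volume.restrict Ω)) := by
  have hlI := integrableOn_Ioo_of_locallyIntegrableOn hkl.locallyIntegrable_right T
  have h1I : IntegrableOn (fun _ : ℝ => (1 : ℝ)) (Ioo 0 T) :=
    integrableOn_const measure_Ioo_lt_top.ne
  obtain ⟨A, hA⟩ := exists_clm_timeConv (μ := volume.restrict Ω) (F := F) hlI
  obtain ⟨J, hJ⟩ := exists_clm_timeConv (μ := volume.restrict Ω) (F := F) h1I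
  -- Nonnegativity of the form is a closed condition, so it passes from the range of `J` to its
  -- closure, which is everything.
  have hclosed : IsClosed {v | 0 ≤ inner ℝ (A v) v} :=
    isClosed_le continuous_const (by fun_prop)
  have hJA : ∀ q, 0 ≤ inner ℝ (A (J q)) (J q) := by
    intro q
    rw [L2.inner_def]
    refine (integral_inner_timeConv_one_nonneg hkl (Lp.memLp q)).trans_eq (integral_congr_ae ?_)
    filter_upwards [hA (J q), hJ q, timeConv_congr (EventuallyEq.refl _ l) (hJ q)] with p h1 h2 h3
    rw [h1, h2, h3]
  have hdense : (LinearMap.range J.toLinearMap).topologicalClosure = ⊤ := by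
    rw [Submodule.topologicalClosure_eq_top_iff, Submodule.eq_bot_iff]
    intro v hv
    rw [Lp.eq_zero_iff_ae_eq_zero]
    refine ae_eq_zero_of_forall_integral_inner_timeConv_one hΩ (Lp.memLp v) fun q hq => ?_
    have := (Submodule.mem_orthogonal _ _).1 hv (J hq.toLp) ⟨hq.toLp, rfl⟩
    rw [L2.inner_def] at this
    refine Eq.trans (integral_congr_ae ?_) this
    filter_upwards [hJ hq.toLp, timeConv_congr (EventuallyEq.refl _ fun _ => 1) hq.coeFn_toLp]
      with p h1 h2
    rw [h1, h2]
  have hmem : hw.toLp ∈ {v | 0 ≤ inner ℝ (A v) v} := by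
    have h1 : closure (LinearMap.range J.toLinearMap : Set _) ⊆ {v | 0 ≤ inner ℝ (A v) v} := by
      refine hclosed.closure_subset_iff.2 ?_
      rintro _ ⟨q, rfl⟩
      exact hJA q
    refine h1 ?_
    rw [← Submodule.topologicalClosure_coe, hdense]
    trivial
  rw [mem_ofPred_eq, L2.inner_def] at hmem
  refine hmem.trans_eq (integral_congr_ae ?_)
  filter_upwards [hA hw.toLp, hw.coeFn_toLp,
    timeConv_congr (EventuallyEq.refl _ l) hw.coeFn_toLp] with p h1 h2 h3
  rw [h1, h2, h3]

end Cylinder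

/-! ### Weak derivatives on an interval and removal of the regularization. -/

section WeakDerivative

variable {T : ℝ}

theorem IsTestFunction.sub {X : Type*} [NormedAddCommGroup X] [NormedSpace ℝ X] {U : Set X}
    {φ ψ : X → ℝ} (hφ : IsTestFunction U φ) (hψ : IsTestFunction U ψ) :
    IsTestFunction U (fun x => φ x - ψ x) := by
  have h : tsupport (fun x => φ x - ψ x) ⊆ tsupport φ ∪ tsupport ψ := tsupport_sub φ ψ
  exact ⟨hφ.smooth.sub hψ.smooth, (hφ.compact.union hψ.compact).of_isClosed_subset
    (isClosed_tsupport _) h, h.trans (union_subset hφ.support_subset hψ.support_subset)⟩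

theorem IsTestFunction.const_mul {X : Type*} [NormedAddCommGroup X] [NormedSpace ℝ X] {U : Set X}
    {φ : X → ℝ} (hφ : IsTestFunction U φ) (c : ℝ) : IsTestFunction U (fun x => c * φ x) :=
  ⟨contDiff_const.mul hφ.smooth, hφ.compact.mul_left,
    (tsupport_mul_subset_right (f := fun _ => c)).trans hφ.support_subset⟩

theorem IsTestFunction.eq_zero {X : Type*} [NormedAddCommGroup X] [NormedSpace ℝ X] {U : Set X}
    {φ : X → ℝ} (hφ : IsTestFunction U φ) {x : X} (hx : x ∉ U) : φ x = 0 :=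
  image_eq_zero_of_notMem_tsupport fun h => hx (hφ.support_subset h)

theorem IsTestFunction.setIntegral_eq {X : Type*} [NormedAddCommGroup X] [NormedSpace ℝ X]
    [MeasurableSpace X] {μ : Measure X} {U : Set X}
    {φ : X → ℝ} (hφ : IsTestFunction U φ) : ∫ x in U, φ x ∂μ = ∫ x, φ x ∂μ :=
  setIntegral_eq_integral_of_forall_compl_eq_zero fun _ hx => hφ.eq_zero hx

theorem IsTestFunction.integrable_mul {X : Type*} [NormedAddCommGroup X] [NormedSpace ℝ X]
    [MeasurableSpace X] [BorelSpace X] [SecondCountableTopology X] {μ : Measure X} {U : Set X}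
    {φ m : X → ℝ} (hφ : IsTestFunction U φ) (hm : Integrable m μ) :
    Integrable (fun x => φ x * m x) μ := by
  obtain ⟨C, hC⟩ := hφ.compact.exists_bound_of_continuous hφ.smooth.continuous
  exact hm.bdd_mul hφ.smooth.continuous.aestronglyMeasurable (ae_of_all _ hC)

theorem exists_isTestFunction_integral_eq_one (hT : 0 < T) :
    ∃ ρ : ℝ → ℝ, IsTestFunction (Ioo 0 T) ρ ∧ ∫ t, ρ t = 1 := by
  let b : ContDiffBump (T / 2) := ⟨T / 8, T / 4, by linarith, by linarith⟩
  refine ⟨b.normed volume, ⟨b.contDiff_normed, b.hasCompactSupport_normed, ?_⟩, b.integral_normed⟩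
  rw [b.tsupport_normed_eq, Real.closedBall_eq_Icc]
  have hr : b.rOut = T / 4 := rfl
  exact fun t ht => ⟨by linarith [ht.1], by linarith [ht.2]⟩

/-- A test function on an interval with vanishing integral is the derivative of a test function. -/
theorem IsTestFunction.exists_primitive (hT : 0 < T) {ψ : ℝ → ℝ} (hψ : IsTestFunction (Ioo 0 T) ψ)
    (h0 : ∫ t, ψ t = 0) : ∃ η, IsTestFunction (Ioo 0 T) η ∧ deriv η = ψ := by
  -- The added point keeps the compact set nonempty when `ψ = 0`, so that it has a least and a
  -- greatest element.
  have hK : IsCompact (insert (T / 2) (tsupport ψ)) := hψ.compact.insert _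
  have hKs : insert (T / 2) (tsupport ψ) ⊆ Ioo 0 T :=
    insert_subset ⟨by linarith, by linarith⟩ hψ.support_subset
  obtain ⟨a, ha⟩ := hK.exists_isLeast (insert_nonempty _ _)
  obtain ⟨b, hb⟩ := hK.exists_isGreatest (insert_nonempty _ _)
  have haI := hKs ha.1
  have hbI := hKs hb.1
  have hz : ∀ t, t < a ∨ b < t → ψ t = 0 := by
    intro t ht
    refine image_eq_zero_of_notMem_tsupport fun h => ?_
    rcases ht with ht | ht
    · exact absurd (ha.2 (mem_insert_of_mem _ h)) (not_le.2 ht)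
    · exact absurd (hb.2 (mem_insert_of_mem _ h)) (not_le.2 ht)
  set η : ℝ → ℝ := fun t => ∫ s in (0 : ℝ)..t, ψ s with hη
  have hd : ∀ t, HasDerivAt η (ψ t) t := fun t =>
    intervalIntegral.integral_hasDerivAt_right (hψ.smooth.continuous.intervalIntegrable _ _)
      hψ.smooth.continuous.stronglyMeasurable.stronglyMeasurableAtFilter
      hψ.smooth.continuous.continuousAt
  have hder : deriv η = ψ := funext fun t => (hd t).deriv
  have hsupp : Function.support η ⊆ Icc a b := by
    intro t ht
    by_contra hab
    refine ht ?_
    rw [mem_Icc, not_and_or, not_le, not_le] at hab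
    rcases hab with hab | hab
    · simp only [hη]
      rw [intervalIntegral.integral_congr (g := fun _ => (0 : ℝ)) fun s hs => ?_]
      · simp
      · refine hz s (Or.inl ?_)
        rcases le_total 0 t with h | h
        · rw [uIcc_of_le h] at hs; exact hs.2.trans_lt hab
        · rw [uIcc_of_ge h] at hs; exact hs.2.trans_lt haI.1
    · simp only [hη]
      rw [intervalIntegral.integral_eq_integral_of_support_subset, h0]
      intro s hs
      have : ¬ (s < a ∨ b < s) := fun h => hs (hz s h)
      rw [not_or, not_lt, not_lt] at this
      exact ⟨haI.1.trans_le this.1, this.2.trans hab.le⟩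
  refine ⟨η, ⟨?_, HasCompactSupport.of_support_subset_isCompact isCompact_Icc hsupp, ?_⟩, hder⟩
  · exact contDiff_infty_iff_deriv.2 ⟨fun t => (hd t).differentiableAt, hder ▸ hψ.smooth⟩
  · exact (closure_minimal hsupp isClosed_Icc).trans (Icc_subset_Ioo haI.1 hbI.2)

/-- The lemma of du Bois-Reymond. -/
theorem exists_ae_eq_const_of_integral_mul_deriv_eq_zero (hT : 0 < T) {m : ℝ → ℝ}
    (hm : IntegrableOn m (Ioo 0 T))
    (h : ∀ η, IsTestFunction (Ioo 0 T) η → ∫ t in Ioo 0 T, m t * deriv η t = 0) :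
    ∃ c : ℝ, ∀ᵐ t ∂(volume.restrict (Ioo 0 T)), m t = c := by
  obtain ⟨ρ, hρ, hρ1⟩ := exists_isTestFunction_integral_eq_one hT
  refine ⟨∫ t in Ioo 0 T, ρ t * m t, ?_⟩
  set c := ∫ t in Ioo 0 T, ρ t * m t with hc
  have hcI : IntegrableOn (fun _ : ℝ => c) (Ioo 0 T) := integrableOn_const measure_Ioo_lt_top.ne
  have key := isOpen_Ioo.ae_eq_zero_of_integral_contDiff_smul_eq_zero (μ := volume)
    (f := fun t => m t - c)
    (IntegrableOn.locallyIntegrableOn (hm.sub hcI)) fun φ h1 h2 h3 => ?_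
  · rw [ae_restrict_iff' measurableSet_Ioo]
    filter_upwards [key] with t ht htI
    exact sub_eq_zero.1 (ht htI)
  have hφ : IsTestFunction (Ioo 0 T) φ := ⟨h1, h2, h3⟩
  have hφI : Integrable φ := h1.continuous.integrable_of_hasCompactSupport h2
  have hρI : Integrable ρ := hρ.smooth.continuous.integrable_of_hasCompactSupport hρ.compact
  -- Subtracting `(∫ φ) ρ` makes the integral zero, so the result is the derivative of a test
  -- function.
  have hψ := hφ.sub (hρ.const_mul (∫ t, φ t))
  obtain ⟨η, hη, hder⟩ := hψ.exists_primitive hT (by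
    rw [integral_sub hφI (hρI.const_mul _), integral_const_mul, hρ1, mul_one, sub_self])
  have h4 := h η hη
  rw [hder] at h4
  have e1 : ∫ t in Ioo 0 T, m t * (φ t - (∫ t, φ t) * ρ t) =
      (∫ t in Ioo 0 T, φ t * m t) - (∫ t, φ t) * c := by
    rw [hc, ← integral_const_mul, ← integral_sub (hφ.integrable_mul hm)
      ((hρ.integrable_mul hm).const_mul _)]
    refine integral_congr_ae (ae_of_all _ fun t => ?_)
    simp only
    ring
  rw [e1] at h4
  have e2 : ∫ t, φ t • (m t - c) = ∫ t in Ioo 0 T, φ t • (m t - c) :=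
    (setIntegral_eq_integral_of_forall_compl_eq_zero fun t ht => by
      rw [hφ.eq_zero ht, zero_smul]).symm
  rw [e2]
  simp only [smul_eq_mul, mul_sub]
  rw [integral_sub (hφ.integrable_mul hm) (hφ.integrable_mul hcI), integral_mul_const,
    hφ.setIntegral_eq]
  exact h4

theorem IsTestFunction.deriv {η : ℝ → ℝ} (hη : IsTestFunction (Ioo 0 T) η) :
    IsTestFunction (Ioo 0 T) (deriv η) :=
  ⟨(contDiff_infty_iff_deriv.1 hη.smooth).2, hη.compact.deriv,
    (tsupport_deriv_subset).trans hη.support_subset⟩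

/-- `∫ η' (1 ∗ d) = - ∫ η d`. -/
theorem IsTestFunction.integral_deriv_mul_conv_one {η d : ℝ → ℝ}
    (hη : IsTestFunction (Ioo 0 T) η) (hd : IntegrableOn d (Ioo 0 T)) :
    ∫ t in Ioo 0 T, conv (fun _ => 1) d t * _root_.deriv η t = -∫ t in Ioo 0 T, d t * η t := by
  have hη'c := hη.deriv.smooth.continuous
  have hη'I : IntegrableOn (_root_.deriv η) (Ioo 0 T) :=
    (hη'c.integrable_of_hasCompactSupport hη.deriv.compact).integrableOn
  have hI : Integrable (fun p : ℝ × ℝ => {p : ℝ × ℝ | p.2 < p.1}.indicator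
      (fun p => _root_.deriv η p.1 * d p.2) p)
      ((volume.restrict (Ioo 0 T)).prod (volume.restrict (Ioo 0 T))) :=
    (Integrable.mul_prod hη'I hd).indicator (measurableSet_lt measurable_snd measurable_fst)
  have e1 : ∀ t ∈ Ioo 0 T, conv (fun _ => 1) d t * _root_.deriv η t =
      ∫ s in Ioo 0 T, {p : ℝ × ℝ | p.2 < p.1}.indicator
        (fun p => _root_.deriv η p.1 * d p.2) (t, s) := by
    intro t ht
    have : (fun s => {p : ℝ × ℝ | p.2 < p.1}.indicator
        (fun p => _root_.deriv η p.1 * d p.2) (t, s)) =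
        (Iio t).indicator fun s => _root_.deriv η t * d s := by
      ext s; simp [indicator_apply]
    rw [this, integral_indicator measurableSet_Iio, Measure.restrict_restrict measurableSet_Iio,
      inter_comm, Ioo_inter_Iio, min_eq_right ht.2.le, integral_const_mul, conv_one,
      intervalIntegral.integral_of_le ht.1.le, integral_Ioc_eq_integral_Ioo, mul_comm]
  have e2 : ∀ s ∈ Ioo 0 T, ∫ t in Ioo 0 T, {p : ℝ × ℝ | p.2 < p.1}.indicator
        (fun p => _root_.deriv η p.1 * d p.2) (t, s) = -(d s * η s) := by
    intro s hs
    have : (fun t => {p : ℝ × ℝ | p.2 < p.1}.indicator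
        (fun p => _root_.deriv η p.1 * d p.2) (t, s)) =
        (Ioi s).indicator fun t => _root_.deriv η t * d s := by
      ext t; simp [indicator_apply]
    rw [this, integral_indicator measurableSet_Ioi, Measure.restrict_restrict measurableSet_Ioi,
      inter_comm, Ioo_inter_Ioi, max_eq_right hs.1.le, integral_mul_const,
      ← integral_Ioc_eq_integral_Ioo, ← intervalIntegral.integral_of_le hs.2.le,
      intervalIntegral.integral_deriv_eq_sub
        (fun t _ => (hη.smooth.differentiable (by simp)).differentiableAt)
        (hη'c.intervalIntegrable _ _), hη.eq_zero (x := T) fun h => lt_irrefl _ h.2]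
    ring
  rw [setIntegral_congr_fun measurableSet_Ioo e1, integral_integral_swap
    (f := fun t s => {p : ℝ × ℝ | p.2 < p.1}.indicator
        (fun p => _root_.deriv η p.1 * d p.2) (t, s)) hI,
    setIntegral_congr_fun measurableSet_Ioo e2, integral_neg]

/-- The bound `b (1 ∗ h)` is continuous and tends to zero as `t → 0`. -/
theorem eq_zero_of_ae_abs_le_conv_one (hT : 0 < T) {b c : ℝ} {h : ℝ → ℝ}
    (hh : IntegrableOn h (Ioo 0 T))
    (hc : ∀ᵐ t ∂(volume.restrict (Ioo 0 T)), |c| ≤ b * conv (fun _ => 1) h t) : c = 0 := by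
  by_contra hc0
  have h1 := (continuousOn_conv_one hT.le hh) 0 (left_mem_Icc.2 hT.le)
  have h2 : Tendsto (fun t => b * conv (fun _ => 1) h t) (𝓝[Icc 0 T] 0) (𝓝 0) := by
    have := h1.tendsto.const_mul b
    rwa [conv_one, intervalIntegral.integral_same, mul_zero] at this
  have h3 := h2.eventually_lt_const (abs_pos.2 hc0)
  rw [eventually_iff, Metric.mem_nhdsWithin_iff] at h3
  obtain ⟨ε, hε, h3⟩ := h3
  have hpos : 0 < min ε T := lt_min hε hT
  have h4 : ∀ᵐ t ∂(volume.restrict (Ioo 0 (min ε T))), |c| ≤ b * conv (fun _ => 1) h t :=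
    ae_mono (Measure.restrict_mono_set _ (Ioo_subset_Ioo_right (min_le_right _ _))) hc
  have : (ae (volume.restrict (Ioo 0 (min ε T)))).NeBot := by
    rw [ae_neBot, Ne, Measure.restrict_eq_zero, Real.volume_Ioo]
    simpa using hpos
  obtain ⟨t, ht, htI⟩ := (h4.and (ae_restrict_mem measurableSet_Ioo)).exists
  have htlt := h3 ⟨by
    rw [Metric.mem_ball, Real.dist_eq, sub_zero, abs_of_pos htI.1]
    exact htI.2.trans_le (min_le_left _ _), htI.1.le, (htI.2.trans_le (min_le_right _ _)).le⟩
  exact absurd ht (not_le.2 htlt)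

theorem ae_abs_conv_le {h w : ℝ → ℝ} {C : ℝ} (hh : IntegrableOn h (Ioo 0 T))
    (hw : ∀ᵐ t ∂(volume.restrict (Ioo 0 T)), |w t| ≤ C) :
    ∀ᵐ t ∂(volume.restrict (Ioo 0 T)),
      |conv h w t| ≤ C * conv (fun _ => 1) (fun s => ‖h s‖) t := by
  have h1I : IntegrableOn (fun _ : ℝ => (1 : ℝ)) (Ioo 0 T) :=
    integrableOn_const measure_Ioo_lt_top.ne
  filter_upwards [ae_intervalIntegrable_conv hh.norm h1I, ae_restrict_mem measurableSet_Ioo]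
    with t h1 ht
  rw [conv_comm (fun _ => 1), conv_eq_setIntegral _ _ ht.1.le, conv_eq_setIntegral _ _ ht.1.le,
    ← integral_const_mul]
  rw [intervalIntegrable_iff_integrableOn_Ioo_of_le ht.1.le] at h1
  rw [← Real.norm_eq_abs]
  refine norm_integral_le_of_norm_le (h1.const_mul C) ?_
  have h2 : ∀ᵐ s ∂(volume.restrict (Ioo 0 t)), |w s| ≤ C :=
    ae_mono (Measure.restrict_mono_set _ (Ioo_subset_Ioo_right ht.2.le)) hw
  filter_upwards [h2] with s hs
  simp only [smul_eq_mul, mul_one, norm_mul, Real.norm_eq_abs]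
  rw [mul_comm]
  exact mul_le_mul_of_nonneg_right hs (abs_nonneg _)

theorem ae_conv_conv_swap {k l v : ℝ → ℝ} (hk : IntegrableOn k (Ioo 0 T))
    (hl : IntegrableOn l (Ioo 0 T)) (hv : IntegrableOn v (Ioo 0 T)) :
    ∀ᵐ t ∂(volume.restrict (Ioo 0 T)), conv k (conv l v) t = conv l (conv k v) t := by
  filter_upwards [conv_assoc hk hl hv, conv_assoc hl hk hv] with t h1 h2
  rw [← h1, ← h2, funext (conv_comm k l)]

/-- The time-regularized equation `∂_t (k ∗ h ∗ U) + h ∗ g = 0` implies `U + l ∗ g = 0`. -/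
theorem IsResolventKernel.ae_add_conv_eq_zero {k l h U g d : ℝ → ℝ} {γ C : ℝ}
    (hh : IsResolventKernel γ l h) (hγ : γ ≠ 0) (hkl : IsPCPair k l) (hT : 0 < T)
    (hU : IntegrableOn U (Ioo 0 T)) (hg : IntegrableOn g (Ioo 0 T))
    (hd : ∀ᵐ t ∂(volume.restrict (Ioo 0 T)), d t + conv h g t = 0)
    (hderiv : ∀ η, IsTestFunction (Ioo 0 T) η →
      ∫ t in Ioo 0 T, conv (conv k h) U t * deriv η t = -∫ t in Ioo 0 T, d t * η t)
    (hC : ∀ᵐ t ∂(volume.restrict (Ioo 0 T)), |conv k U t| ≤ C) :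
    ∀ᵐ t ∂(volume.restrict (Ioo 0 T)), U t + conv l g t = 0 := by
  have hkI := integrableOn_Ioo_of_locallyIntegrableOn hkl.locallyIntegrable_left T
  have hlI := integrableOn_Ioo_of_locallyIntegrableOn hkl.locallyIntegrable_right T
  have hhI := integrableOn_Ioo_of_locallyIntegrableOn hh.locallyIntegrable T
  have h1I : IntegrableOn (fun _ : ℝ => (1 : ℝ)) (Ioo 0 T) :=
    integrableOn_const measure_Ioo_lt_top.ne
  have hres : volume.restrict (Ioo 0 T) ≤ volume.restrict (Ioi (0 : ℝ)) :=
    Measure.restrict_mono_set _ Ioo_subset_Ioi_self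
  have hkU := integrableOn_conv hkI hU
  have h1g := integrableOn_conv h1I hg
  have hhg := integrableOn_conv hhI hg
  -- Since `h ∗ w = k ∗ h ∗ U + 1 ∗ (h ∗ g)`, its weak derivative is `d + h ∗ g = 0`, and `h ∗ w` is
  -- constant.
  set w : ℝ → ℝ := fun t => conv k U t + conv (fun _ => 1) g t with hw
  have hwI : IntegrableOn w (Ioo 0 T) := hkU.add h1g
  have hhw : ∀ᵐ t ∂(volume.restrict (Ioo 0 T)),
      conv h w t = conv (conv k h) U t + conv (fun _ => 1) (conv h g) t := by
    filter_upwards [conv_add hhI hkU h1g, conv_assoc hhI hkI hU, ae_conv_conv_swap hhI h1I hg]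
      with t e1 e2 e3
    rw [e1, ← e2, funext (conv_comm h k), e3]
  have hmI := integrableOn_conv (integrableOn_conv hkI hhI) hU
  have h1hg := integrableOn_conv h1I hhg
  obtain ⟨c, hc⟩ := exists_ae_eq_const_of_integral_mul_deriv_eq_zero hT
    (integrableOn_conv hhI hwI) fun η hη => by
      have e1 : ∫ t in Ioo 0 T, conv h w t * deriv η t = ∫ t in Ioo 0 T,
          (conv (conv k h) U t * deriv η t + conv (fun _ => 1) (conv h g) t * deriv η t) := by
        refine integral_congr_ae (hhw.mono fun t ht => ?_)
        simp only [ht, add_mul]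
      have i1 := hη.deriv.integrable_mul hmI
      have i2 := hη.deriv.integrable_mul h1hg
      simp only [mul_comm (deriv η _)] at i1 i2
      rw [e1, integral_add i1 i2, hderiv η hη, hη.integral_deriv_mul_conv_one hhg,
        integral_congr_ae (g := fun t => -(conv h g t * η t)) (hd.mono fun t ht => ?_),
        integral_neg]
      · ring
      · simp only [eq_neg_of_add_eq_zero_left ht, neg_mul]
  have hwC : ∀ᵐ t ∂(volume.restrict (Ioo 0 T)), |w t| ≤ C + ∫ s in Ioo 0 T, ‖g s‖ := by
    filter_upwards [hC, ae_restrict_mem measurableSet_Ioo] with t h1 ht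
    refine (abs_add_le _ _).trans (add_le_add h1 ?_)
    rw [conv_eq_setIntegral _ _ ht.1.le]
    simp only [one_smul]
    exact (norm_integral_le_integral_norm _).trans (setIntegral_mono_set hg.norm
      (ae_of_all _ fun _ => norm_nonneg _) (Ioo_subset_Ioo_right ht.2.le).eventuallyLE)
  -- Boundedness of `w` gives `|h ∗ w| ≤ const · (1 ∗ |h|)`, which is small near `t = 0`. The
  -- initial condition enters here.
  have hc0 : c = 0 := by
    refine eq_zero_of_ae_abs_le_conv_one (b := C + ∫ s in Ioo 0 T, ‖g s‖) hT hhI.norm ?_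
    filter_upwards [ae_abs_conv_le hhI hwC, hc] with t h1 h2
    rw [← h2]; exact h1
  have hw0 := hh.ae_eq_zero_of_conv_eq_zero hγ hkl hT hwI (hc.mono fun t ht => ht.trans hc0)
  have hlg := integrableOn_conv hlI hg
  -- From `w = 0` follows `0 = l ∗ w = 1 ∗ U + 1 ∗ (l ∗ g)`, because `l ∗ k = 1`.
  refine ae_eq_zero_of_conv_one_eq_zero hT (hU.add hlg) ?_
  filter_upwards [conv_add h1I hU hlg, conv_add hlI hkU h1g, conv_assoc hlI hkI hU,
    ae_conv_conv_swap hlI h1I hg, ae_restrict_mem measurableSet_Ioo] with t e1 e2 e3 e4 ht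
  have e5 : conv l w t = 0 := by
    rw [conv_congr (T := T) (EventuallyEq.refl _ l) hw0 ht]
    simp [conv]
  refine e1.trans ?_
  rw [← e5, e2, ← e3, funext (conv_comm l k), conv_congr (T := T) (ae_mono hres hkl.conv_eq_one)
    (EventuallyEq.refl _ U) ht, e4]

end WeakDerivative

/-! ### Time slices and pairings in space. -/

section Slices

variable {X : Type*} [MeasurableSpace X] {μ : Measure X} [IsFiniteMeasure μ]
  {F : Type*} [NormedAddCommGroup F] {T : ℝ}

theorem ae_memLp_two_slice {ν : Measure ℝ} [SFinite ν] {w : ℝ × X → F}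
    (hw : MemLp w 2 (ν.prod μ)) : ∀ᵐ t ∂ν, MemLp (fun x => w (t, x)) 2 μ := by
  have h2 := (memLp_two_iff_integrable_sq_norm hw.aestronglyMeasurable).1 hw
  filter_upwards [h2.prod_right_ae, hw.aestronglyMeasurable.prodMk_left] with t h1 h3
  exact (memLp_two_iff_integrable_sq_norm h3).2 h1

variable [InnerProductSpace ℝ F]

theorem integrable_inner_snd {w : ℝ × X → F} {g : X → F}
    (hw : MemLp w 2 ((volume.restrict (Ioo 0 T)).prod μ)) (hg : MemLp g 2 μ) :
    Integrable (fun p : ℝ × X => inner ℝ (w p) (g p.2)) ((volume.restrict (Ioo 0 T)).prod μ) :=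
  integrable_inner_of_memLp_two hw (hg.comp_snd _)

/-- Convolution in time commutes with pairing against a function of the space variable. -/
theorem ae_integral_inner_timeConv [CompleteSpace F] {k : ℝ → ℝ} {w : ℝ × X → F} {g : X → F}
    (hk : IntegrableOn k (Ioo 0 T))
    (hw : MemLp w 2 ((volume.restrict (Ioo 0 T)).prod μ)) (hg : MemLp g 2 μ) :
    ∀ᵐ t ∂(volume.restrict (Ioo 0 T)),
      Integrable (fun x => inner ℝ (timeConv k w (t, x)) (g x)) μ ∧
      ∫ x, inner ℝ (timeConv k w (t, x)) (g x) ∂μ =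
        conv k (fun s => ∫ x, inner ℝ (w (s, x)) (g x) ∂μ) t := by
  have hI := integrable_inner_snd hw hg
  have h1 : timeConv k (fun p : ℝ × X => inner ℝ (w p) (g p.2))
      =ᵐ[(volume.restrict (Ioo 0 T)).prod μ] fun p => inner ℝ (timeConv k w p) (g p.2) := by
    filter_upwards [ae_timeConv_eq (T := T) k w,
      ae_timeConv_eq (T := T) k (fun p : ℝ × X => inner ℝ (w p) (g p.2)),
      ae_setIntegral_integrable hk (hw.integrable one_le_two)] with p e1 e2 e3
    rw [e1, e2, real_inner_comm, ← integral_inner e3]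
    refine integral_congr_ae (ae_of_all _ fun s => ?_)
    simp only [smul_eq_mul, inner_smul_right, real_inner_comm]
  have hc := Measure.ae_ae_of_ae_prod h1
  filter_upwards [ae_integral_timeConv hk hI, hc,
    (integrable_inner_snd (memLp_timeConv hk hw).1 hg).prod_right_ae] with t e1 e2 e3
  exact ⟨e3, by rw [← e1]; exact integral_congr_ae (e2.mono fun x hx => hx.symm)⟩

end Slices

/-! ### Test functions in `H̊^1_2` and a countable dense family. -/

section Sobolev

variable {N : ℕ} {Ω : Set (EuclideanSpace ℝ (Fin N))}

theorem inner_gradient_eq_fderiv (φ : EuclideanSpace ℝ (Fin N) → ℝ)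
    (x e : EuclideanSpace ℝ (Fin N)) : inner ℝ e (gradient φ x) = fderiv ℝ φ x e := by
  rw [real_inner_comm, gradient, InnerProductSpace.toDual_symm_apply]

theorem IsTestFunction.continuous_gradient {φ : EuclideanSpace ℝ (Fin N) → ℝ}
    (hφ : IsTestFunction Ω φ) : Continuous (gradient φ) :=
  (InnerProductSpace.toDual ℝ (EuclideanSpace ℝ (Fin N))).symm.continuous.comp
    (hφ.smooth.continuous_fderiv (by simp))

theorem IsTestFunction.support_gradient_subset {φ : EuclideanSpace ℝ (Fin N) → ℝ} :
    Function.support (gradient φ) ⊆ Function.support (fderiv ℝ φ) := by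
  intro x hx h0
  exact hx (by rw [gradient, h0, map_zero])

theorem IsTestFunction.hasCompactSupport_gradient {φ : EuclideanSpace ℝ (Fin N) → ℝ}
    (hφ : IsTestFunction Ω φ) : HasCompactSupport (gradient φ) :=
  (hφ.compact.fderiv ℝ).mono IsTestFunction.support_gradient_subset

theorem IsTestFunction.isWeakGradient {φ : EuclideanSpace ℝ (Fin N) → ℝ}
    (hφ : IsTestFunction Ω φ) : IsWeakGradient Ω φ (gradient φ) := by
  intro χ hχ
  rw [setIntegral_eq_integral_of_forall_compl_eq_zero fun x hx => by
      rw [hφ.eq_zero hx, zero_smul],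
    setIntegral_eq_integral_of_forall_compl_eq_zero fun x hx => by
      rw [hχ.eq_zero hx, zero_smul]]
  have i1 : Integrable fun x => φ x • gradient χ x :=
    (hφ.smooth.continuous.smul hχ.continuous_gradient).integrable_of_hasCompactSupport
      hφ.compact.smul_right
  have i2 : Integrable fun x => χ x • gradient φ x :=
    (hχ.smooth.continuous.smul hφ.continuous_gradient).integrable_of_hasCompactSupport
      hχ.compact.smul_right
  refine ext_inner_left ℝ fun e => ?_
  rw [inner_neg_right, ← integral_inner i1, ← integral_inner i2]
  simp_rw [inner_smul_right, inner_gradient_eq_fderiv]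
  have hc1 : Continuous fun x => fderiv ℝ φ x e :=
    (hφ.smooth.continuous_fderiv (by simp)).clm_apply continuous_const
  have hc2 : Continuous fun x => fderiv ℝ χ x e :=
    (hχ.smooth.continuous_fderiv (by simp)).clm_apply continuous_const
  rw [integral_mul_fderiv_eq_neg_fderiv_mul_of_integrable]
  · simp_rw [mul_comm]
  · exact (hc1.mul hχ.smooth.continuous).integrable_of_hasCompactSupport hχ.compact.mul_left
  · exact (hφ.smooth.continuous.mul hc2).integrable_of_hasCompactSupport hφ.compact.mul_right
  · exact (hφ.smooth.continuous.mul hχ.smooth.continuous).integrable_of_hasCompactSupport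
      hφ.compact.mul_right
  · exact fun x _ => (hφ.smooth.differentiable (by simp)).differentiableAt
  · exact fun x _ => (hχ.smooth.differentiable (by simp)).differentiableAt

theorem IsTestFunction.memH10 {φ : EuclideanSpace ℝ (Fin N) → ℝ}
    (hφ : IsTestFunction Ω φ) : MemH10 Ω φ (gradient φ) where
  memLp := (hφ.smooth.continuous.memLp_of_hasCompactSupport hφ.compact).restrict Ω
  memLp_grad := (hφ.continuous_gradient.memLp_of_hasCompactSupport
    hφ.hasCompactSupport_gradient).restrict Ω
  weakGradient := hφ.isWeakGradient
  approx := fun ε hε => ⟨φ, hφ, by simpa using hε, by simpa using hε⟩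

theorem isTestFunction_zero : IsTestFunction Ω fun _ => (0 : ℝ) :=
  ⟨contDiff_const, HasCompactSupport.zero, by simp [tsupport]⟩

/-- There is a countable family of test functions that suffices for testing a linear equation
against all of `H̊^1_2`. -/
theorem exists_countable_testFunctions (Ω : Set (EuclideanSpace ℝ (Fin N))) :
    ∃ φ : ℕ → EuclideanSpace ℝ (Fin N) → ℝ, (∀ j, IsTestFunction Ω (φ j)) ∧
      ∀ (v : EuclideanSpace ℝ (Fin N) → ℝ)
        (q : EuclideanSpace ℝ (Fin N) → EuclideanSpace ℝ (Fin N)),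
        MemLp v 2 (volume.restrict Ω) → MemLp q 2 (volume.restrict Ω) →
        (∀ j, (∫ x in Ω, inner ℝ (v x) (φ j x)) +
          ∫ x in Ω, inner ℝ (q x) (gradient (φ j) x) = 0) →
        ∀ w g, MemH10 Ω w g →
          (∫ x in Ω, inner ℝ (v x) (w x)) + ∫ x in Ω, inner ℝ (q x) (g x) = 0 := by
  set H := Lp ℝ 2 (volume.restrict Ω) × Lp (EuclideanSpace ℝ (Fin N)) 2 (volume.restrict Ω)
  let S : Set H := {p | ∃ φ, IsTestFunction Ω φ ∧ p.1 =ᵐ[volume.restrict Ω] φ ∧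
    p.2 =ᵐ[volume.restrict Ω] gradient φ}
  have : Fact ((2 : ℝ≥0∞) ≠ ⊤) := ⟨by simp⟩
  have h1 : SecondCountableTopology (Lp ℝ 2 (volume.restrict Ω)) := inferInstance
  have h2 : SecondCountableTopology (Lp (EuclideanSpace ℝ (Fin N)) 2 (volume.restrict Ω)) :=
    inferInstance
  have : TopologicalSpace.SeparableSpace H := inferInstanceAs (TopologicalSpace.SeparableSpace
    (Lp ℝ 2 (volume.restrict Ω) × Lp (EuclideanSpace ℝ (Fin N)) 2 (volume.restrict Ω)))
  -- Pairs `(φ, ∇φ)` lie in the separable space `L_2 × L_2`, so a countable subset of them is dense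
  -- among them. Pairing with `(v, q)` is continuous, and `approx` places `(w, ∇w)` in the closure.
  obtain ⟨C, hCS, hC, hSC⟩ :=
    (TopologicalSpace.IsSeparable.of_separableSpace S).exists_countable_dense_subset
  have hSmem : ∀ χ (hχ : IsTestFunction Ω χ),
      (hχ.memH10.memLp.toLp, hχ.memH10.memLp_grad.toLp) ∈ S := fun χ hχ =>
    ⟨χ, hχ, hχ.memH10.memLp.coeFn_toLp, hχ.memH10.memLp_grad.coeFn_toLp⟩
  have hSne : S.Nonempty := ⟨_, hSmem _ isTestFunction_zero⟩
  have hCne : C.Nonempty := closure_nonempty_iff.1 (hSne.mono hSC)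
  obtain ⟨e, rfl⟩ := hC.exists_eq_range hCne
  choose φ hφ h1 h2 using fun j => hCS (mem_range_self j)
  refine ⟨φ, hφ, fun v q hv hq hj w g hwg => ?_⟩
  have hΛ : Continuous fun p : H => inner ℝ hv.toLp p.1 + inner ℝ hq.toLp p.2 := by fun_prop
  have hclosed : IsClosed {p : H | inner ℝ hv.toLp p.1 + inner ℝ hq.toLp p.2 = 0} :=
    isClosed_eq hΛ continuous_const
  have hinner : ∀ (p : H) (w' : EuclideanSpace ℝ (Fin N) → ℝ)
      (g' : EuclideanSpace ℝ (Fin N) → EuclideanSpace ℝ (Fin N)),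
      p.1 =ᵐ[volume.restrict Ω] w' → p.2 =ᵐ[volume.restrict Ω] g' →
      inner ℝ hv.toLp p.1 + inner ℝ hq.toLp p.2 =
        (∫ x in Ω, inner ℝ (v x) (w' x)) + ∫ x in Ω, inner ℝ (q x) (g' x) := by
    intro p w' g' e1 e2
    rw [L2.inner_def, L2.inner_def]
    congr 1
    · refine integral_congr_ae ?_
      filter_upwards [hv.coeFn_toLp, e1] with x e3 e4
      rw [e3, e4]
    · refine integral_congr_ae ?_
      filter_upwards [hq.coeFn_toLp, e2] with x e3 e4
      rw [e3, e4]
  have hsub : closure (range e) ⊆ {p : H | inner ℝ hv.toLp p.1 + inner ℝ hq.toLp p.2 = 0} := by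
    refine hclosed.closure_subset_iff.2 ?_
    rintro _ ⟨j, rfl⟩
    exact (hinner _ _ _ (h1 j) (h2 j)).trans (hj j)
  have hmem : (hwg.memLp.toLp, hwg.memLp_grad.toLp) ∈ closure S := by
    rw [EMetric.mem_closure_iff]
    intro ε hε
    obtain ⟨χ, hχ, a1, a2⟩ := hwg.approx ε hε
    refine ⟨_, hSmem χ hχ, ?_⟩
    rw [Prod.edist_eq, Lp.edist_toLp_toLp, Lp.edist_toLp_toLp]
    exact max_lt a1 a2
  have := hsub (closure_minimal hSC isClosed_closure hmem)
  rw [← hinner (hwg.memLp.toLp, hwg.memLp_grad.toLp) w g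
    hwg.memLp.coeFn_toLp hwg.memLp_grad.coeFn_toLp]
  exact this

end Sobolev

/-! ### The difference of two solutions tested in space. -/

section Uniqueness

variable {N : ℕ} {T : ℝ} {Ω : Set (EuclideanSpace ℝ (Fin N))}

theorem IsTestFunction.mul_prod {η : ℝ → ℝ} {φ : EuclideanSpace ℝ (Fin N) → ℝ}
    (hη : IsTestFunction (Ioo 0 T) η) (hφ : IsTestFunction Ω φ) :
    IsTestFunction (cylinder T Ω) fun p => η p.1 * φ p.2 := by
  have hsub : Function.support (fun p : ℝ × EuclideanSpace ℝ (Fin N) => η p.1 * φ p.2) ⊆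
      tsupport η ×ˢ tsupport φ := by
    intro p hp
    exact ⟨subset_tsupport _ (left_ne_zero_of_mul hp), subset_tsupport _ (right_ne_zero_of_mul hp)⟩
  refine ⟨(hη.smooth.comp contDiff_fst).mul (hφ.smooth.comp contDiff_snd),
    HasCompactSupport.of_support_subset_isCompact (hη.compact.prod hφ.compact) hsub, ?_⟩
  exact (closure_minimal hsub ((isClosed_tsupport _).prod (isClosed_tsupport _))).trans
    (prod_mono hη.support_subset hφ.support_subset)

/-- Products `η(t) φ(x)` turn the weak derivative in `Ω_T` into that of a scalar function of time.
-/
theorem integral_mul_mul_timeConv [IsFiniteMeasure (volume.restrict Ω)] {κ η : ℝ → ℝ}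
    {φ : EuclideanSpace ℝ (Fin N) → ℝ} {w : ℝ × EuclideanSpace ℝ (Fin N) → ℝ}
    (hκ : IntegrableOn κ (Ioo 0 T)) (hη : IsTestFunction (Ioo 0 T) η) (hφ : IsTestFunction Ω φ)
    (hw : MemLp w 2 (volume.restrict (cylinder T Ω))) :
    Integrable (fun p => timeConv κ w p * (η p.1 * φ p.2)) (volume.restrict (cylinder T Ω)) ∧
    ∫ p in cylinder T Ω, timeConv κ w p * (η p.1 * φ p.2) =
      ∫ t in Ioo 0 T, conv κ (fun s => ∫ x in Ω, inner ℝ (w (s, x)) (φ x)) t * η t := by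
  rw [volume_restrict_cylinder] at hw ⊢
  have hI : Integrable (fun p => timeConv κ w p * (η p.1 * φ p.2))
      ((volume.restrict (Ioo 0 T)).prod (volume.restrict Ω)) := by
    have := (hη.mul_prod hφ).integrable_mul ((memLp_timeConv hκ hw).1.integrable one_le_two)
    simpa only [mul_comm] using this
  refine ⟨hI, ?_⟩
  rw [integral_prod _ hI]
  refine integral_congr_ae ?_
  filter_upwards [ae_integral_inner_timeConv hκ hw hφ.memH10.memLp] with t ht
  rw [← ht.2, ← integral_mul_const]
  refine integral_congr_ae (ae_of_all _ fun x => ?_)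
  simp only [RCLike.inner_apply, conj_trivial]
  ring

theorem integral_mul_mul [IsFiniteMeasure (volume.restrict Ω)] {η : ℝ → ℝ}
    {φ : EuclideanSpace ℝ (Fin N) → ℝ} {D : ℝ × EuclideanSpace ℝ (Fin N) → ℝ}
    (hη : IsTestFunction (Ioo 0 T) η) (hφ : IsTestFunction Ω φ)
    (hD : MemLp D 2 (volume.restrict (cylinder T Ω))) :
    ∫ p in cylinder T Ω, D p * (η p.1 * φ p.2) =
      ∫ t in Ioo 0 T, (∫ x in Ω, inner ℝ (D (t, x)) (φ x)) * η t := by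
  rw [volume_restrict_cylinder] at hD ⊢
  have hI : Integrable (fun p => D p * (η p.1 * φ p.2))
      ((volume.restrict (Ioo 0 T)).prod (volume.restrict Ω)) := by
    have := (hη.mul_prod hφ).integrable_mul (hD.integrable one_le_two)
    simpa only [mul_comm] using this
  rw [integral_prod _ hI]
  refine integral_congr_ae (ae_of_all _ fun t => ?_)
  simp only
  rw [← integral_mul_const]
  refine integral_congr_ae (ae_of_all _ fun x => ?_)
  simp only [RCLike.inner_apply, conj_trivial]
  ring

/-- The tested weak time derivative of a difference of two functions. -/
theorem integral_conv_mul_deriv_eq [IsFiniteMeasure (volume.restrict Ω)] {κ : ℝ → ℝ}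
    {φ : EuclideanSpace ℝ (Fin N) → ℝ} {v₁ v₂ D₁ D₂ : ℝ × EuclideanSpace ℝ (Fin N) → ℝ}
    (hκ : IntegrableOn κ (Ioo 0 T)) (hφ : IsTestFunction Ω φ)
    (hv₁ : MemLp v₁ 2 (volume.restrict (cylinder T Ω)))
    (hv₂ : MemLp v₂ 2 (volume.restrict (cylinder T Ω)))
    (hD₁ : MemLp D₁ 2 (volume.restrict (cylinder T Ω)))
    (hD₂ : MemLp D₂ 2 (volume.restrict (cylinder T Ω)))
    (h₁ : IsWeakTimeDeriv T Ω (timeConv κ v₁) D₁) (h₂ : IsWeakTimeDeriv T Ω (timeConv κ v₂) D₂)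
    {η : ℝ → ℝ} (hη : IsTestFunction (Ioo 0 T) η) :
    ∫ t in Ioo 0 T, conv κ (fun s => ∫ x in Ω, inner ℝ (v₁ (s, x) - v₂ (s, x)) (φ x)) t *
        deriv η t =
      -∫ t in Ioo 0 T, (∫ x in Ω, inner ℝ (D₁ (t, x) - D₂ (t, x)) (φ x)) * η t := by
  have hd : ∀ p : ℝ × EuclideanSpace ℝ (Fin N),
      deriv (fun s => η s * φ p.2) p.1 = deriv η p.1 * φ p.2 := fun p =>
    deriv_mul_const (hη.smooth.differentiable (by simp)).differentiableAt _
  have e1 := h₁ _ (hη.mul_prod hφ)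
  have e2 := h₂ _ (hη.mul_prod hφ)
  simp only [hd] at e1 e2
  obtain ⟨-, i3⟩ := integral_mul_mul_timeConv hκ hη.deriv hφ (hv₁.sub hv₂)
  obtain ⟨i1, -⟩ := integral_mul_mul_timeConv hκ hη.deriv hφ hv₁
  obtain ⟨i2, -⟩ := integral_mul_mul_timeConv hκ hη.deriv hφ hv₂
  have i4 := integral_mul_mul hη hφ (hD₁.sub hD₂)
  simp only [Pi.sub_apply] at i3 i4
  rw [← i3, ← i4]
  have hs : timeConv κ (v₁ - v₂) =ᵐ[volume.restrict (cylinder T Ω)]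
      fun p => timeConv κ v₁ p - timeConv κ v₂ p := by
    rw [volume_restrict_cylinder] at hv₁ hv₂ ⊢
    exact timeConv_sub hκ (hv₁.integrable one_le_two) (hv₂.integrable one_le_two)
  have hfin : IsFiniteMeasure (volume.restrict (cylinder T Ω)) := by
    rw [volume_restrict_cylinder]; infer_instance
  have j1 := (hη.mul_prod hφ).integrable_mul (hD₁.integrable one_le_two)
  have j2 := (hη.mul_prod hφ).integrable_mul (hD₂.integrable one_le_two)
  simp only [mul_comm (_ * _)] at j1 j2
  calc _ = ∫ p in cylinder T Ω, (timeConv κ v₁ p * (deriv η p.1 * φ p.2) -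
        timeConv κ v₂ p * (deriv η p.1 * φ p.2)) := by
        refine integral_congr_ae (hs.mono fun p hp => ?_)
        simp only [hp, sub_mul]
    _ = -((∫ p in cylinder T Ω, D₁ p * (η p.1 * φ p.2)) -
        ∫ p in cylinder T Ω, D₂ p * (η p.1 * φ p.2)) := by
        rw [integral_sub i1 i2, e1, e2]; ring
    _ = _ := by
        rw [← integral_sub j1 j2]
        simp only [sub_mul]

/-- A continuous curve in `L_2(Ω)` is bounded on the compact `[0, T]`. This is the bound that forces
the integration constant to vanish. -/
theorem exists_ae_abs_conv_le [IsFiniteMeasure (volume.restrict Ω)] {k : ℝ → ℝ}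
    {φ : EuclideanSpace ℝ (Fin N) → ℝ} {u₁ u₂ : ℝ × EuclideanSpace ℝ (Fin N) → ℝ}
    (hk : IntegrableOn k (Ioo 0 T)) (hφ : IsTestFunction Ω φ)
    (hu₁ : MemLp u₁ 2 (volume.restrict (cylinder T Ω)))
    (hu₂ : MemLp u₂ 2 (volume.restrict (cylinder T Ω)))
    (h₁ : IsContinuousL2VanishingAtZero T Ω (timeConv k u₁))
    (h₂ : IsContinuousL2VanishingAtZero T Ω (timeConv k u₂)) :
    ∃ C, ∀ᵐ t ∂(volume.restrict (Ioo 0 T)),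
      |conv k (fun s => ∫ x in Ω, inner ℝ (u₁ (s, x) - u₂ (s, x)) (φ x)) t| ≤ C := by
  rw [volume_restrict_cylinder] at hu₁ hu₂
  obtain ⟨V₁, hV₁, -, hV₁u⟩ := h₁
  obtain ⟨V₂, hV₂, -, hV₂u⟩ := h₂
  obtain ⟨C, hC⟩ := isCompact_Icc.exists_bound_of_continuousOn (hV₁.sub hV₂)
  have hφL := hφ.memH10.memLp
  refine ⟨C * ‖hφL.toLp‖, ?_⟩
  have hs := Measure.ae_ae_of_ae_prod (timeConv_sub hk (hu₁.integrable one_le_two)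
    (hu₂.integrable one_le_two))
  filter_upwards [hV₁u, hV₂u, hs, ae_integral_inner_timeConv hk (hu₁.sub hu₂) hφL,
    ae_restrict_mem measurableSet_Ioo] with t e1 e2 e3 e4 ht
  have e5 : conv k (fun s => ∫ x in Ω, inner ℝ (u₁ (s, x) - u₂ (s, x)) (φ x)) t =
      inner ℝ (V₁ t - V₂ t) hφL.toLp := by
    refine e4.2.symm.trans ?_
    rw [L2.inner_def]
    refine integral_congr_ae ?_
    filter_upwards [e1, e2, e3, Lp.coeFn_sub (V₁ t) (V₂ t), hφL.coeFn_toLp] with x a1 a2 a3 a4 a5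
    rw [a4, a5, Pi.sub_apply, a1, a2]
    exact congrArg (fun y => inner ℝ y (φ x)) a3
  rw [e5]
  refine (abs_real_inner_le_norm _ _).trans ?_
  exact mul_le_mul_of_nonneg_right (hC t (Ioo_subset_Icc_self ht)) (norm_nonneg _)

/-- The difference of two weak solutions, tested with a single test function, solves the
equation obtained by convolving with `l`. -/
theorem ae_tested_difference_eq_zero [IsFiniteMeasure (volume.restrict Ω)] (hT : 0 < T)
    {k l h : ℝ → ℝ} (hkl : IsPCPair k l) (hh : IsResolventKernel 1 l h)
    {φ : EuclideanSpace ℝ (Fin N) → ℝ} (hφ : IsTestFunction Ω φ)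
    {u₁ u₂ D₁ D₂ : ℝ × EuclideanSpace ℝ (Fin N) → ℝ} {u₀ : EuclideanSpace ℝ (Fin N) → ℝ}
    {G₁ G₂ : ℝ × EuclideanSpace ℝ (Fin N) → EuclideanSpace ℝ (Fin N)} {R : ℝ → ℝ}
    (hu₀ : MemLp u₀ 2 (volume.restrict Ω))
    (hu₁ : MemLp u₁ 2 (volume.restrict (cylinder T Ω)))
    (hu₂ : MemLp u₂ 2 (volume.restrict (cylinder T Ω)))
    (hc₁ : IsContinuousL2VanishingAtZero T Ω (timeConv k u₁))
    (hc₂ : IsContinuousL2VanishingAtZero T Ω (timeConv k u₂))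
    (hG₁ : MemLp G₁ 2 (volume.restrict (cylinder T Ω)))
    (hG₂ : MemLp G₂ 2 (volume.restrict (cylinder T Ω)))
    (hD₁ : MemLp D₁ 2 (volume.restrict (cylinder T Ω)))
    (hD₂ : MemLp D₂ 2 (volume.restrict (cylinder T Ω)))
    (hw₁ : IsWeakTimeDeriv T Ω (timeConv (conv k h) fun p => u₁ p - u₀ p.2) D₁)
    (hw₂ : IsWeakTimeDeriv T Ω (timeConv (conv k h) fun p => u₂ p - u₀ p.2) D₂)
    (he₁ : ∀ᵐ t ∂(volume.restrict (Ioo 0 T)),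
      ∫ x in Ω, (φ x * D₁ (t, x) + inner ℝ (timeConv h G₁ (t, x)) (gradient φ x)) = R t)
    (he₂ : ∀ᵐ t ∂(volume.restrict (Ioo 0 T)),
      ∫ x in Ω, (φ x * D₂ (t, x) + inner ℝ (timeConv h G₂ (t, x)) (gradient φ x)) = R t) :
    ∀ᵐ t ∂(volume.restrict (Ioo 0 T)),
      (∫ x in Ω, inner ℝ (u₁ (t, x) - u₂ (t, x)) (φ x)) +
        ∫ x in Ω, inner ℝ (timeConv l (G₁ - G₂) (t, x)) (gradient φ x) = 0 := by
  have hkI := integrableOn_Ioo_of_locallyIntegrableOn hkl.locallyIntegrable_left T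
  have hlI := integrableOn_Ioo_of_locallyIntegrableOn hkl.locallyIntegrable_right T
  have hhI := integrableOn_Ioo_of_locallyIntegrableOn hh.locallyIntegrable T
  have hφL := hφ.memH10.memLp
  have hφG := hφ.memH10.memLp_grad
  obtain ⟨C, hC⟩ := exists_ae_abs_conv_le hkI hφ hu₁ hu₂ hc₁ hc₂
  have hu₀' : MemLp (fun p : ℝ × EuclideanSpace ℝ (Fin N) => u₀ p.2) 2
      (volume.restrict (cylinder T Ω)) := by
    rw [volume_restrict_cylinder]; exact hu₀.comp_snd _
  have hderiv := fun η hη => integral_conv_mul_deriv_eq (η := η) (integrableOn_conv hkI hhI) hφ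
    (hu₁.sub hu₀') (hu₂.sub hu₀') hD₁ hD₂ hw₁ hw₂ hη
  simp only [Pi.sub_apply, sub_sub_sub_cancel_right] at hderiv
  rw [volume_restrict_cylinder] at hu₁ hu₂ hG₁ hG₂ hD₁ hD₂
  have hU := (integrable_inner_snd (hu₁.sub hu₂) hφL).integral_prod_left
  have hg := (integrable_inner_snd (hG₁.sub hG₂) hφG).integral_prod_left
  have hd : ∀ᵐ t ∂(volume.restrict (Ioo 0 T)),
      (∫ x in Ω, inner ℝ (D₁ (t, x) - D₂ (t, x)) (φ x)) +
        conv h (fun s => ∫ x in Ω, inner ℝ ((G₁ - G₂) (s, x)) (gradient φ x)) t = 0 := by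
    have hs := Measure.ae_ae_of_ae_prod (timeConv_sub hhI (hG₁.integrable one_le_two)
      (hG₂.integrable one_le_two))
    filter_upwards [he₁, he₂, ae_integral_inner_timeConv hhI hG₁ hφG,
      ae_integral_inner_timeConv hhI hG₂ hφG, ae_integral_inner_timeConv hhI (hG₁.sub hG₂) hφG,
      (integrable_inner_snd hD₁ hφL).prod_right_ae, (integrable_inner_snd hD₂ hφL).prod_right_ae,
      hs] with t a1 a2 b1 b2 b3 i1 i2 hs
    simp only [RCLike.inner_apply, conj_trivial] at i1 i2 ⊢
    rw [integral_add i1 b1.1] at a1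
    rw [integral_add i2 b2.1] at a2
    rw [← b3.2]
    have c1 : ∫ x in Ω, inner ℝ (timeConv h (G₁ - G₂) (t, x)) (gradient φ x) =
        (∫ x in Ω, inner ℝ (timeConv h G₁ (t, x)) (gradient φ x)) -
          ∫ x in Ω, inner ℝ (timeConv h G₂ (t, x)) (gradient φ x) := by
      rw [← integral_sub b1.1 b2.1]
      refine integral_congr_ae (hs.mono fun x hx => ?_)
      beta_reduce
      rw [← inner_sub_left]
      exact congrArg (fun y => inner ℝ y (gradient φ x)) hx
    have c2 : ∫ x in Ω, φ x * (D₁ (t, x) - D₂ (t, x)) =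
        (∫ x in Ω, φ x * D₁ (t, x)) - ∫ x in Ω, φ x * D₂ (t, x) := by
      rw [← integral_sub i1 i2]
      simp only [mul_sub]
    rw [c1, c2]
    linarith
  have hfin := hh.ae_add_conv_eq_zero one_ne_zero hkl hT hU hg hd hderiv hC
  filter_upwards [hfin, ae_integral_inner_timeConv hlI (hG₁.sub hG₂) hφG] with t e1 e2
  rw [e2.2]
  exact e1

theorem mul_sub_nonneg_of_strictMono {Φ : ℝ → ℝ} (hΦ : StrictMono Φ) (r s : ℝ) :
    0 ≤ (r - s) * (Φ r - Φ s) := by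
  rcases le_total r s with h | h
  · exact mul_nonneg_of_nonpos_of_nonpos (sub_nonpos.2 h) (sub_nonpos.2 (hΦ.monotone h))
  · exact mul_nonneg (sub_nonneg.2 h) (sub_nonneg.2 (hΦ.monotone h))

end Uniqueness

end Subdiffusion

/-! ### Uniqueness by the monotonicity argument. -/

open Subdiffusion in
theorem mainTheorem2 {N : ℕ} (T : ℝ) (hT : 0 < T)
    (Ω : Set (EuclideanSpace ℝ (Fin N))) (hΩ_open : IsOpen Ω) (hΩ_conn : IsConnected Ω)
    (hΩ_bdd : Bornology.IsBounded Ω)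
    (k l : ℝ → ℝ) (hkl : Subdiffusion.IsPCPair k l)
    (Φ : ℝ → ℝ) (hΦ_cont : Continuous Φ) (hΦ_mono : StrictMono Φ) (hΦ_zero : Φ 0 = 0)
    (a : ℝ × EuclideanSpace ℝ (Fin N) → ℝ)
    (ha_meas : AEStronglyMeasurable a (volume.restrict (Subdiffusion.cylinder T Ω)))
    (a₁ a₂ : ℝ) (ha₁ : 0 < a₁)
    (ha : ∀ᵐ p ∂(volume.restrict (Subdiffusion.cylinder T Ω)), a₁ ≤ a p ∧ a p ≤ a₂)
    (u₀ : EuclideanSpace ℝ (Fin N) → ℝ) (hu₀ : MemLp u₀ 2 (volume.restrict Ω))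
    (f : ℝ × EuclideanSpace ℝ (Fin N) → ℝ)
    (hf : MemLp f 2 (volume.restrict (Subdiffusion.cylinder T Ω)))
    (u₁ u₂ : ℝ × EuclideanSpace ℝ (Fin N) → ℝ)
    (hu₁ : Subdiffusion.IsWeakSolution T Ω k l a Φ u₀ f u₁)
    (hu₂ : Subdiffusion.IsWeakSolution T Ω k l a Φ u₀ f u₂) :
    u₁ =ᵐ[volume.restrict (Subdiffusion.cylinder T Ω)] u₂ := by
  have hfin : IsFiniteMeasure (volume.restrict Ω) :=
    isFiniteMeasure_restrict.2 hΩ_bdd.measure_lt_top.ne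
  have hlI := integrableOn_Ioo_of_locallyIntegrableOn hkl.locallyIntegrable_right T
  obtain ⟨G₁, hG₁, hw₁⟩ := hu₁.weak_form
  obtain ⟨G₂, hG₂, hw₂⟩ := hu₂.weak_form
  obtain ⟨D₁, hD₁, hd₁, he₁⟩ := hw₁ 1 one_pos
  obtain ⟨D₂, hD₂, hd₂, he₂⟩ := hw₂ 1 one_pos
  have hh : IsResolventKernel 1 l (resolventKernel ((1 : ℕ) : ℝ) l) := by
    rw [Nat.cast_one]
    exact isResolventKernel_resolventKernel 1 hkl.locallyIntegrable_right
  obtain ⟨φ, hφ, hφtest⟩ := exists_countable_testFunctions Ω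
  -- Countability of the family yields one null set of times valid for all `j`, so that test
  -- functions depending on `t` become admissible.
  have htested : ∀ᵐ t ∂(volume.restrict (Ioo 0 T)), ∀ j,
      (∫ x in Ω, inner ℝ (u₁ (t, x) - u₂ (t, x)) (φ j x)) +
        ∫ x in Ω, inner ℝ (timeConv l (G₁ - G₂) (t, x)) (gradient (φ j) x) = 0 :=
    ae_all_iff.2 fun j => ae_tested_difference_eq_zero hT hkl hh (hφ j) hu₀ hu₁.memLp hu₂.memLp
      hu₁.continuous_conv hu₂.continuous_conv hG₁.memLp_grad hG₂.memLp_grad hD₁ hD₂ hd₁ hd₂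
      (he₁ _ _ (hφ j).memH10) (he₂ _ _ (hφ j).memH10)
  have hu : MemLp (u₁ - u₂) 2 ((volume.restrict (Ioo 0 T)).prod (volume.restrict Ω)) := by
    rw [← volume_restrict_cylinder]; exact hu₁.memLp.sub hu₂.memLp
  have hG : MemLp (G₁ - G₂) 2 ((volume.restrict (Ioo 0 T)).prod (volume.restrict Ω)) := by
    rw [← volume_restrict_cylinder]; exact hG₁.memLp_grad.sub hG₂.memLp_grad
  have hz : MemLp (fun p => a p * Φ (u₁ p) - a p * Φ (u₂ p)) 2
      ((volume.restrict (Ioo 0 T)).prod (volume.restrict Ω)) := by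
    rw [← volume_restrict_cylinder]; exact hG₁.memLp.sub hG₂.memLp
  have hlG := (memLp_timeConv hlI hG).1
  have hIu := integrable_inner_of_memLp_two hu hz
  have hIG := integrable_inner_of_memLp_two hlG hG
  have hslice : ∀ᵐ t ∂(volume.restrict (Ioo 0 T)),
      (∫ x in Ω, inner ℝ ((u₁ - u₂) (t, x)) (a (t, x) * Φ (u₁ (t, x)) - a (t, x) * Φ (u₂ (t, x)))) +
        ∫ x in Ω, inner ℝ (timeConv l (G₁ - G₂) (t, x)) ((G₁ - G₂) (t, x)) = 0 := by
    filter_upwards [htested, ae_memLp_two_slice hu, ae_memLp_two_slice hlG, hG₁.memH10,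
      hG₂.memH10] with t e1 e2 e3 e4 e5
    -- The slices of `a Φ(u₁)` and `a Φ(u₂)` at time `t` are inserted separately and the two
    -- identities subtracted.
    have f1 := hφtest _ _ e2 e3 e1 _ _ e4
    have f2 := hφtest _ _ e2 e3 e1 _ _ e5
    simp only [inner_sub_right, Pi.sub_apply (f := G₁)]
    rw [integral_sub (integrable_inner_of_memLp_two e2 e4.memLp)
        (integrable_inner_of_memLp_two e2 e5.memLp),
      integral_sub (integrable_inner_of_memLp_two e3 e4.memLp_grad)
        (integrable_inner_of_memLp_two e3 e5.memLp_grad)]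
    linarith
  have hsum : (∫ p, inner ℝ ((u₁ - u₂) p) (a p * Φ (u₁ p) - a p * Φ (u₂ p))
        ∂((volume.restrict (Ioo 0 T)).prod (volume.restrict Ω))) +
      ∫ p, inner ℝ (timeConv l (G₁ - G₂) p) ((G₁ - G₂) p)
        ∂((volume.restrict (Ioo 0 T)).prod (volume.restrict Ω)) = 0 := by
    rw [integral_prod _ hIu, integral_prod _ hIG,
      ← integral_add hIu.integral_prod_left hIG.integral_prod_left]
    exact integral_eq_zero_of_ae hslice
  have hpos := integral_inner_timeConv_nonneg hΩ_open hkl hG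
  rw [volume_restrict_cylinder] at ha ⊢
  have hnn : 0 ≤ᵐ[(volume.restrict (Ioo 0 T)).prod (volume.restrict Ω)]
      fun p => inner ℝ ((u₁ - u₂) p) (a p * Φ (u₁ p) - a p * Φ (u₂ p)) := by
    filter_upwards [ha] with p hp
    have := mul_nonneg (ha₁.le.trans hp.1) (mul_sub_nonneg_of_strictMono hΦ_mono (u₁ p) (u₂ p))
    simp only [RCLike.inner_apply, conj_trivial, Pi.sub_apply, Pi.zero_apply]
    linarith
  -- Two nonnegative integrals with sum zero both vanish, so the nonnegative integrand of the first
  -- is zero almost everywhere.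
  have hzero := (integral_eq_zero_iff_of_nonneg_ae hnn hIu).1
    (le_antisymm (by linarith) (integral_nonneg_of_ae hnn))
  filter_upwards [hzero, ha] with p hp hap
  simp only [RCLike.inner_apply, conj_trivial, Pi.sub_apply, Pi.zero_apply, ← mul_sub] at hp
  rcases mul_eq_zero.1 hp with h | h
  · rcases mul_eq_zero.1 h with h | h
    · exact absurd h (ha₁.trans_le hap.1).ne'
    · exact hΦ_mono.injective (sub_eq_zero.1 h)
  · exact sub_eq_zero.1 h
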